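/- Let $A\in\mathbb R^{n\times n}$, $B\in\mathbb R^{n\times p}$, $C\in\mathbb R^{m\times n}$, $D\in\mathbb R^{m\times p}$ be such that $(A,B,C,D)$ is minimal, that is, controllable and observable: $$\operatorname{rank}[\,B\mid AB\mid\cdots\mid A^{n-1}B\,]=n,\qquad \operatorname{rank}[\,C;\,CA;\,\dots;\,CA^{n-1}\,]=n .$$ Consider the linear system $x_{t+1}=Ax_t+Bu_t+B_ww_t$, $y_t=Cx_t+Du_t+D_zz_t$ $(t\ge 1)$, started at a deterministic state $x_1\in\mathbb R^n$, with process and sensor noise identically zero ($w_t=0$, $z_t=0$) and i.i.d. inputs $u_t\sim\mathcal N(0,I_p)$. For $T\ge1$ put $$\bar u_t=[u_t\mid u_{t-1}\mid\cdots\mid u_{t-T+1}]\in\mathbb R^{Tp},\qquad G_\star=[D\mid CB\mid CAB\mid\cdots\mid CA^{T-2}B]\in\mathbb R^{m\times Tp},$$ and for $T\le N_1\le N/10$ let $$\widehat G_{\mathrm{LS}}\in\operatorname*{arg\,min}_{G\in\mathbb R^{m\times Tp}}\ \sum_{t=N_1}^{N}\|G\bar u_t-y_t\|_2^2$$ be any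 ordinary least squares estimate. 1. (Lower bound.) There is a universal constant $c>0$ such that the following holds. If a Jordan decomposition of $A$ over $\mathbb C$ has a block of size $k$ with eigenvalue $\lambda$, $|\lambda|=1$, then there is a constant $\mathsf C>0$ that depends only on $A,B,C$ (with their dimensions) and $k$ such that, for every $D,B_w,D_z,x_1$ and every $T\ge1$, there is an $N_0$ such that for all $N\ge N_0$ and all $N_1$ with $T\le N_1\le N/10$, $$\Pr\left[\ \|\widehat G_{\mathrm{LS}}-G_\star\|_{\mathrm{op}}\ \ge\ \mathsf C\,N^{k-1}\ \right]\ \ge\ c .$$ 2. (Inconsistency.) If $A$ has spectral radius $\rho(A)=1$ (a marginally stable system), then for every $T\ge1$ and every choice of $N_1=N_1(N)$ with $T\le N_1(N)\le N/10$ for all large $N$, the ordinary least squares estimates $\widehat G_{\mathrm{LS}}=\widehat G_{\mathrm{LS}}(N)$ do not converge to $G_\star$ in probability as $N\to\infty$. -/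

import Mathlib

open MeasureTheory ProbabilityTheory Filter Topology
open scoped Matrix Matrix.Norms.L2Operator

noncomputable section

namespace OLSLowerBound

/-- The `k × k` upper triangular Jordan block with eigenvalue `ev`. -/
def jordanBlock (ev : ℂ) (k : ℕ) : Matrix (Fin k) (Fin k) ℂ :=
  Matrix.of fun i j => if i = j then ev else if i.val + 1 = j.val then 1 else 0

/-- A Jordan decomposition `A = S J S⁻¹` over `ℂ` of the real matrix `A` contains a block of size
`k` with eigenvalue `ev`. -/
def HasJordanBlock {n : ℕ} (A : Matrix (Fin n) (Fin n) ℝ) (ev : ℂ) (k : ℕ) : Prop :=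
  ∃ (r : ℕ) (size : Fin r → ℕ) (eig : Fin r → ℂ) (e : (Σ i, Fin (size i)) ≃ Fin n)
    (S : Matrix (Fin n) (Fin n) ℂ),
    (∀ i, 1 ≤ size i) ∧ IsUnit S ∧
    A.map (fun a : ℝ => (a : ℂ)) =
      S * Matrix.reindex e e (Matrix.blockDiagonal' fun i => jordanBlock (eig i) (size i)) * S⁻¹ ∧
    ∃ i, eig i = ev ∧ size i = k

/-- The controllability matrix `[B | A B | ⋯ | A^(n-1) B]`. -/
def controllabilityMatrix {n p : ℕ} (A : Matrix (Fin n) (Fin n) ℝ) (B : Matrix (Fin n) (Fin p) ℝ) :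
    Matrix (Fin n) (Fin n × Fin p) ℝ :=
  Matrix.of fun i jl => (A ^ (jl.1 : ℕ) * B) i jl.2

/-- The observability matrix, with block rows `C`, `C A`, …, `C A^(n-1)`. -/
def observabilityMatrix {n m : ℕ} (A : Matrix (Fin n) (Fin n) ℝ) (C : Matrix (Fin m) (Fin n) ℝ) :
    Matrix (Fin n × Fin m) (Fin n) ℝ :=
  Matrix.of fun jl i => (C * A ^ (jl.1 : ℕ)) jl.2 i

/-- Minimality of `(A, B, C, D)`: controllable and observable (`D` plays no role). -/
def IsMinimal {n m p : ℕ} (A : Matrix (Fin n) (Fin n) ℝ) (B : Matrix (Fin n) (Fin p) ℝ)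
    (C : Matrix (Fin m) (Fin n) ℝ) : Prop :=
  (controllabilityMatrix A B).rank = n ∧ (observabilityMatrix A C).rank = n

/-- The sequences (indexed by times `t ≥ 1`) obey the dynamics
`x_{t+1} = A x_t + B u_t + B_w w_t`, `y_t = C x_t + D u_t + D_z z_t` from the initial state `xinit`. -/
structure IsTrajectory {n m p dw dz : ℕ} (A : Matrix (Fin n) (Fin n) ℝ)
    (B : Matrix (Fin n) (Fin p) ℝ) (C : Matrix (Fin m) (Fin n) ℝ) (D : Matrix (Fin m) (Fin p) ℝ)
    (Bw : Matrix (Fin n) (Fin dw) ℝ) (Dz : Matrix (Fin m) (Fin dz) ℝ) (xinit : Fin n → ℝ)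
    (u : ℕ → Fin p → ℝ) (w : ℕ → Fin dw → ℝ) (z : ℕ → Fin dz → ℝ)
    (x : ℕ → Fin n → ℝ) (y : ℕ → Fin m → ℝ) : Prop where
  init : x 1 = xinit
  state : ∀ t, 1 ≤ t → x (t + 1) = A *ᵥ x t + B *ᵥ u t + Bw *ᵥ w t
  output : ∀ t, 1 ≤ t → y t = C *ᵥ x t + D *ᵥ u t + Dz *ᵥ z t

/-- The random inputs `u_1, u_2, …` are independent standard Gaussian vectors, `u_t ∼ N(0, I_p)`. -/
structure IsGaussianInput {p : ℕ} {Ω : Type*} [MeasurableSpace Ω] (μ : Measure Ω)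
    (u : ℕ → Ω → Fin p → ℝ) : Prop where
  indep : iIndepFun (fun t : ℕ => u (t + 1)) μ
  law : ∀ t, 1 ≤ t → HasLaw (u t) (Measure.pi fun _ : Fin p => gaussianReal 0 1) μ

/-- The length-`T` response `[D | C B | C A B | ⋯ | C A^(T-2) B]`. -/
def response {n m p : ℕ} (A : Matrix (Fin n) (Fin n) ℝ) (B : Matrix (Fin n) (Fin p) ℝ)
    (C : Matrix (Fin m) (Fin n) ℝ) (D : Matrix (Fin m) (Fin p) ℝ) (T : ℕ) :
    Matrix (Fin m) (Fin T × Fin p) ℝ :=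
  Matrix.of fun i jl =>
    if (jl.1 : ℕ) = 0 then D i jl.2 else (C * A ^ ((jl.1 : ℕ) - 1) * B) i jl.2

/-- The concatenated input `[u_t | u_{t-1} | ⋯ | u_{t-T+1}]` (used for `t ≥ T` only). -/
def concatInput {p : ℕ} (T : ℕ) (u : ℕ → Fin p → ℝ) (t : ℕ) : Fin T × Fin p → ℝ :=
  fun jl => u (t - (jl.1 : ℕ)) jl.2

/-- The sum of squared Euclidean residuals over the times `N₁, …, N`. -/
def squaredLoss {m p : ℕ} (T N₁ N : ℕ) (u : ℕ → Fin p → ℝ) (y : ℕ → Fin m → ℝ)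
    (G : Matrix (Fin m) (Fin T × Fin p) ℝ) : ℝ :=
  ∑ t ∈ Finset.Icc N₁ N, ‖WithLp.toLp 2 (G *ᵥ concatInput T u t - y t)‖ ^ 2

/-- `G` is an ordinary least squares estimate, i.e. a minimizer of the squared loss. -/
def IsOLS {m p : ℕ} (T N₁ N : ℕ) (u : ℕ → Fin p → ℝ) (y : ℕ → Fin m → ℝ)
    (G : Matrix (Fin m) (Fin T × Fin p) ℝ) : Prop :=
  ∀ G' : Matrix (Fin m) (Fin T × Fin p) ℝ, squaredLoss T N₁ N u y G ≤ squaredLoss T N₁ N u y G'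

end OLSLowerBound

end

/-!
Subtracting the linear model `G⋆ ū_t` from `y_t` leaves the contribution `ξ_t` of the inputs older
than `T` steps, and the normal equations read `(Ĝ - G⋆) ∑ ū_t ū_tᵀ = ∑ ξ_t ū_tᵀ`. Compare the two
sides in one row and in the column of a fixed coordinate of the current input `u_t`.

On the right, `ξ_t` depends only on past inputs, so the entry is a martingale transform of Gaussian
white noise. Its variance is at least the energy `∑_t ∑_r ‖C A ^ r B‖²`, its kurtosis is bounded by
a universal constant, and Paley–Zygmund bounds it below with universal probability. On the left,
the column of `∑ ū_t ū_tᵀ` has second moment of order `N²` and is controlled by Markov's inequality.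
Hence `‖Ĝ - G⋆‖² ≳ N⁻² ∑_t ∑_r ‖C A ^ r B‖²`.

By minimality `A ^ r` is recovered from `2n - 1` consecutive Markov parameters by fixed linear maps,
so the growth `‖A ^ r‖ ≳ r ^ (k - 1)` caused by a Jordan block of size `k` passes to the Markov
parameters, and the double sum is of order at least `N ^ (2k)`.
-/

namespace OLSLowerBound

section Moments

variable {Ω : Type*} [MeasurableSpace Ω] {μ : Measure Ω} {X Y : Ω → ℝ}

/-- All absolute moments of `X` are finite; such random variables form an algebra. -/
def HasFiniteMoments (μ : Measure Ω) (X : Ω → ℝ) : Prop :=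
  ∀ q : NNReal, MemLp X q μ

lemma HasFiniteMoments.add (hX : HasFiniteMoments μ X) (hY : HasFiniteMoments μ Y) :
    HasFiniteMoments μ (fun ω => X ω + Y ω) :=
  fun q => (hX q).add (hY q)

lemma HasFiniteMoments.mul (hX : HasFiniteMoments μ X) (hY : HasFiniteMoments μ Y) :
    HasFiniteMoments μ (fun ω => X ω * Y ω) := fun q => by
  have : ENNReal.HolderTriple ((2 * q : NNReal) : ENNReal) ((2 * q : NNReal) : ENNReal) q := ⟨by
    rw [ENNReal.coe_mul, ENNReal.coe_ofNat, ENNReal.mul_inv (by simp) (by simp), ← two_mul,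
      ← mul_assoc, ENNReal.mul_inv_cancel (by norm_num) (by norm_num), one_mul]⟩
  exact (hY (2 * q)).mul' (hX (2 * q))

lemma HasFiniteMoments.const [IsFiniteMeasure μ] (c : ℝ) : HasFiniteMoments μ (fun _ => c) :=
  fun _ => memLp_const c

lemma HasFiniteMoments.const_mul (hX : HasFiniteMoments μ X) (c : ℝ) :
    HasFiniteMoments μ (fun ω => c * X ω) :=
  fun q => (hX q).const_mul c

lemma HasFiniteMoments.pow [IsFiniteMeasure μ] (hX : HasFiniteMoments μ X) (k : ℕ) :
    HasFiniteMoments μ (fun ω => X ω ^ k) := by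
  induction k with
  | zero => simpa using HasFiniteMoments.const 1
  | succ k ih => simpa only [pow_succ] using ih.mul hX

lemma HasFiniteMoments.sum {ι : Type*} {s : Finset ι} {X : ι → Ω → ℝ}
    (hX : ∀ i ∈ s, HasFiniteMoments μ (X i)) : HasFiniteMoments μ (fun ω => ∑ i ∈ s, X i ω) :=
  fun q => memLp_finsetSum s fun i hi => hX i hi q

lemma HasFiniteMoments.memLp_two (hX : HasFiniteMoments μ X) : MemLp X 2 μ := hX 2

lemma HasFiniteMoments.integrable (hX : HasFiniteMoments μ X) : Integrable X μ :=
  memLp_one_iff_integrable.1 (hX 1)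

lemma HasFiniteMoments.aemeasurable (hX : HasFiniteMoments μ X) : AEMeasurable X μ :=
  hX.integrable.aemeasurable

lemma inner_toLp_eq_integral_mul (hX : MemLp X 2 μ) (hY : MemLp Y 2 μ) :
    inner ℝ (hX.toLp X) (hY.toLp Y) = ∫ ω, X ω * Y ω ∂μ := by
  rw [L2.inner_def]
  refine integral_congr_ae ?_
  filter_upwards [hX.coeFn_toLp, hY.coeFn_toLp] with ω hXω hYω
  rw [hXω, hYω, real_inner_eq_re_inner, RCLike.inner_apply]
  simp [mul_comm]

lemma sq_integral_mul_le (hX : MemLp X 2 μ) (hY : MemLp Y 2 μ) :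
    (∫ ω, X ω * Y ω ∂μ) ^ 2 ≤ (∫ ω, X ω ^ 2 ∂μ) * ∫ ω, Y ω ^ 2 ∂μ := by
  simpa only [inner_toLp_eq_integral_mul, real_inner_comm, ← sq]
    using real_inner_mul_inner_self_le (hX.toLp X) (hY.toLp Y)

lemma paley_zygmund [IsProbabilityMeasure μ] (hX : MemLp X 2 μ) (hX0 : 0 ≤ᵐ[μ] X) {θ : ℝ}
    (hθ0 : 0 ≤ θ) (hθ1 : θ ≤ 1) :
    (1 - θ) ^ 2 * (∫ ω, X ω ∂μ) ^ 2 ≤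
      (∫ ω, X ω ^ 2 ∂μ) * μ.real {ω | θ * ∫ ω, X ω ∂μ ≤ X ω} := by
  set m := ∫ ω, X ω ∂μ with hm
  set S := {ω | θ * m ≤ X ω}
  have hSm : NullMeasurableSet S μ :=
    nullMeasurableSet_le aemeasurable_const hX.aestronglyMeasurable.aemeasurable
  have hXint : Integrable X μ := hX.integrable (by norm_num)
  have hm0 : 0 ≤ m := integral_nonneg_of_ae hX0
  have hsplit : m ≤ θ * m + ∫ ω in S, X ω ∂μ := by
    have hle : ∫ ω, X ω ∂μ ≤ ∫ ω, (θ * m + S.indicator X ω) ∂μ := by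
      refine integral_mono hXint ((integrable_const _).add (hXint.indicator₀ hSm)) fun ω => ?_
      by_cases hω : ω ∈ S
      · simpa [hω] using mul_nonneg hθ0 hm0
      · simpa [hω] using (not_le.1 hω).le
    rwa [integral_add (integrable_const _) (hXint.indicator₀ hSm), integral_indicator₀ hSm,
      integral_const, probReal_univ, one_smul, ← hm] at hle
  have hcs : (∫ ω in S, X ω ∂μ) ^ 2 ≤ (∫ ω in S, X ω ^ 2 ∂μ) * μ.real S := by
    simpa using sq_integral_mul_le (μ := μ.restrict S) (hX.restrict S) (memLp_const (1 : ℝ))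
  calc (1 - θ) ^ 2 * m ^ 2 = ((1 - θ) * m) ^ 2 := by ring
    _ ≤ (∫ ω in S, X ω ∂μ) ^ 2 :=
      pow_le_pow_left₀ (mul_nonneg (by linarith) hm0) (by linarith) 2
    _ ≤ (∫ ω in S, X ω ^ 2 ∂μ) * μ.real S := hcs
    _ ≤ (∫ ω, X ω ^ 2 ∂μ) * μ.real S :=
      mul_le_mul_of_nonneg_right
        (setIntegral_le_integral hX.integrable_sq (ae_of_all _ fun ω => sq_nonneg (X ω)))
        measureReal_nonneg

lemma le_measureReal_half_integral_sq_le [IsProbabilityMeasure μ] (hX : HasFiniteMoments μ X)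
    {κ : ℝ} (hκ : 0 < κ) (hpos : 0 < ∫ ω, X ω ^ 2 ∂μ)
    (h4 : ∫ ω, X ω ^ 4 ∂μ ≤ κ * (∫ ω, X ω ^ 2 ∂μ) ^ 2) :
    1 / (4 * κ) ≤ μ.real {ω | 1 / 2 * ∫ ω, X ω ^ 2 ∂μ ≤ X ω ^ 2} := by
  have hPZ := paley_zygmund (hX.pow 2).memLp_two (ae_of_all _ fun ω => sq_nonneg (X ω))
    (θ := 1 / 2) (by norm_num) (by norm_num)
  simp_rw [← pow_mul] at hPZ
  have hprob := hPZ.trans (mul_le_mul_of_nonneg_right h4 measureReal_nonneg)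
  rw [div_le_iff₀ (by positivity)]
  refine le_of_mul_le_mul_left ?_ (pow_pos hpos 2)
  linarith

end Moments

section Gaussian

lemma integrable_pow_gaussianReal (m : ℝ) (v : NNReal) (k : ℕ) :
    Integrable (fun z => z ^ k) (gaussianReal m v) :=
  (HasFiniteMoments.pow (fun q => memLp_id_gaussianReal q) k).integrable

lemma integral_pow_two_gaussianReal : ∫ z, z ^ 2 ∂(gaussianReal 0 1) = 1 := by
  have h := variance_fun_id_gaussianReal (μ := 0) (v := 1)
  rw [variance_eq_integral measurable_id'.aemeasurable] at h
  simpa using h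

lemma integral_pow_gaussianReal_of_odd {k : ℕ} (hk : Odd k) (v : NNReal) :
    ∫ z, z ^ k ∂(gaussianReal 0 v) = 0 := by
  have hneg : ∫ z, z ^ k ∂(gaussianReal 0 v) = ∫ z, (-z) ^ k ∂(gaussianReal 0 v) := by
    conv_lhs => rw [← neg_zero, ← gaussianReal_map_neg]
    exact integral_map (by fun_prop) (by fun_prop)
  simp_rw [hk.neg_pow, integral_neg] at hneg
  linarith

lemma integral_add_mul_pow_two_gaussianReal (x y : ℝ) :
    ∫ z, (x + y * z) ^ 2 ∂(gaussianReal 0 1) = x ^ 2 + y ^ 2 := by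
  have hexpand : ∀ z : ℝ, (x + y * z) ^ 2
      = ∑ k ∈ Finset.range 3, x ^ (2 - k) * y ^ k * (Nat.choose 2 k) * z ^ k := fun z => by
    simp [Finset.sum_range_succ]; ring
  simp_rw [hexpand]
  rw [integral_finsetSum _ fun k _ => (integrable_pow_gaussianReal 0 1 k).const_mul _]
  simp_rw [integral_const_mul]
  simp [Finset.sum_range_succ, integral_pow_two_gaussianReal]

lemma integral_add_mul_pow_four_gaussianReal (x y : ℝ) :
    ∫ z, (x + y * z) ^ 4 ∂(gaussianReal 0 1)
      = x ^ 4 + 6 * (x ^ 2 * y ^ 2) + y ^ 4 * ∫ z, z ^ 4 ∂(gaussianReal 0 1) := by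
  have hexpand : ∀ z : ℝ, (x + y * z) ^ 4
      = ∑ k ∈ Finset.range 5, x ^ (4 - k) * y ^ k * (Nat.choose 4 k) * z ^ k := fun z => by
    simp [Finset.sum_range_succ, Nat.choose]; ring
  simp_rw [hexpand]
  rw [integral_finsetSum _ fun k _ => (integrable_pow_gaussianReal 0 1 k).const_mul _]
  simp_rw [integral_const_mul]
  have hodd : ∫ z, z ^ 3 ∂(gaussianReal 0 1) = 0 :=
    integral_pow_gaussianReal_of_odd (by decide) 1
  simp [Finset.sum_range_succ, Nat.choose, integral_pow_two_gaussianReal, hodd]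
  ring

lemma gaussianReal_zero_eq_map_mul (v : NNReal) :
    gaussianReal 0 v = (gaussianReal 0 1).map (fun z => √v * z) := by
  rw [gaussianReal_map_const_mul, mul_zero, mul_one]
  congr 1
  ext
  simp

/- The fixed point `4 M = M + 6 + M` comes from the two descriptions of `N(0, 2)`: a rescaled
`N(0, 1)`, and the law of a sum of two independent copies of `N(0, 1)`. -/
lemma integral_pow_four_gaussianReal : ∫ z, z ^ 4 ∂(gaussianReal 0 1) = 3 := by
  set M := ∫ z, z ^ 4 ∂(gaussianReal 0 1) with hM
  have hscale : ∫ z, z ^ 4 ∂(gaussianReal 0 2) = 4 * M := by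
    have hsqrt : √(2 : NNReal) ^ 4 = 4 := by
      rw [show 4 = 2 * 2 from rfl, pow_mul, Real.sq_sqrt (NNReal.coe_nonneg 2)]
      norm_num
    rw [gaussianReal_zero_eq_map_mul 2, integral_map (by fun_prop) (by fun_prop)]
    simp_rw [mul_pow, integral_const_mul, hsqrt, hM]
  have hconv : ∫ z, z ^ 4 ∂(gaussianReal 0 2) = M + 6 + M := by
    have h2 : gaussianReal 0 2 = (gaussianReal 0 1).conv (gaussianReal 0 1) := by
      rw [gaussianReal_conv_gaussianReal]
      norm_num
    have hsum (x : ℝ) : ∫ z, (x + z) ^ 4 ∂(gaussianReal 0 1) = x ^ 4 + 6 * x ^ 2 + M := by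
      simpa using integral_add_mul_pow_four_gaussianReal x 1
    have hint := integrable_pow_gaussianReal 0 1
    rw [h2, integral_conv (h2 ▸ integrable_pow_gaussianReal 0 2 4)]
    simp_rw [hsum]
    rw [integral_add ((hint 4).fun_add ((hint 2).const_mul 6)) (integrable_const _),
      integral_add (hint 4) ((hint 2).const_mul 6), integral_const_mul,
      integral_pow_two_gaussianReal]
    simp [hM]
  linarith

variable {Ω : Type*} [MeasurableSpace Ω] {μ : Measure Ω} {g : Ω → ℝ}

lemma HasFiniteMoments.of_hasLaw_gaussianReal {m : ℝ} {v : NNReal}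
    (hg : HasLaw g (gaussianReal m v) μ) : HasFiniteMoments μ g := fun q => by
  have h := memLp_id_gaussianReal (μ := m) (v := v) q
  rwa [← hg.map_eq, memLp_map_measure_iff (by fun_prop) hg.aemeasurable] at h

lemma integral_const_add_gaussian_pow_two {v : NNReal} (hg : HasLaw g (gaussianReal 0 v) μ)
    (x : ℝ) : ∫ ω, (x + g ω) ^ 2 ∂μ = x ^ 2 + v := by
  refine (hg.integral_comp (f := fun z => (x + z) ^ 2) (by fun_prop)).trans ?_
  rw [gaussianReal_zero_eq_map_mul, integral_map (by fun_prop) (by fun_prop),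
    integral_add_mul_pow_two_gaussianReal, Real.sq_sqrt v.coe_nonneg]

lemma integral_const_add_gaussian_pow_four {v : NNReal} (hg : HasLaw g (gaussianReal 0 v) μ)
    (x : ℝ) : ∫ ω, (x + g ω) ^ 4 ∂μ = x ^ 4 + 6 * (x ^ 2 * v) + 3 * v ^ 2 := by
  refine (hg.integral_comp (f := fun z => (x + z) ^ 4) (by fun_prop)).trans ?_
  rw [gaussianReal_zero_eq_map_mul, integral_map (by fun_prop) (by fun_prop),
    integral_add_mul_pow_four_gaussianReal, integral_pow_four_gaussianReal, pow_mul √_ 2 2,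
    Real.sq_sqrt v.coe_nonneg, mul_comm 3]

lemma integral_comp_prodMk_of_indepFun [IsProbabilityMeasure μ] {α β : Type*} [MeasurableSpace α]
    [MeasurableSpace β] {U : Ω → α} {V : Ω → β} {ν : Measure β} (hU : AEMeasurable U μ)
    (hV : HasLaw V ν μ) (h : IndepFun U V μ) {F : α × β → ℝ} (hF : Measurable F)
    (hint : Integrable (fun ω => F (U ω, V ω)) μ) :
    ∫ ω, F (U ω, V ω) ∂μ = ∫ ω, ∫ v, F (U ω, v) ∂ν ∂μ := by
  have : IsProbabilityMeasure ν := hV.isProbabilityMeasure_iff.1 ‹_›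
  have hlaw : HasLaw (fun ω => (U ω, V ω)) ((μ.map U).prod ν) μ :=
    h.hasLaw_prod ⟨hU, rfl⟩ hV
  have hFint : Integrable F ((μ.map U).prod ν) := by
    rwa [← hlaw.map_eq, integrable_map_measure hF.aestronglyMeasurable hlaw.aemeasurable]
  rw [← integral_map hU hFint.integral_prod_left.aestronglyMeasurable, ← integral_prod _ hFint,
    ← hlaw.integral_comp hF.aestronglyMeasurable]
  rfl

variable [IsProbabilityMeasure μ] {X Y : Ω → ℝ}

lemma integral_add_mul_gaussian_pow_two (hX : HasFiniteMoments μ X) (hY : HasFiniteMoments μ Y)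
    (hg : HasLaw g (gaussianReal 0 1) μ) (h : IndepFun (fun ω => (X ω, Y ω)) g μ) :
    ∫ ω, (X ω + Y ω * g ω) ^ 2 ∂μ = (∫ ω, X ω ^ 2 ∂μ) + ∫ ω, Y ω ^ 2 ∂μ := by
  rw [integral_comp_prodMk_of_indepFun (F := fun a => (a.1.1 + a.1.2 * a.2) ^ 2)
    (hX.aemeasurable.prodMk hY.aemeasurable) hg h (by fun_prop)
    ((hX.add (hY.mul (.of_hasLaw_gaussianReal hg))).pow 2).integrable]
  simp_rw [integral_add_mul_pow_two_gaussianReal]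
  exact integral_add (hX.pow 2).integrable (hY.pow 2).integrable

lemma integral_add_mul_gaussian_pow_four (hX : HasFiniteMoments μ X) (hY : HasFiniteMoments μ Y)
    (hg : HasLaw g (gaussianReal 0 1) μ) (h : IndepFun (fun ω => (X ω, Y ω)) g μ) :
    ∫ ω, (X ω + Y ω * g ω) ^ 4 ∂μ
      = (∫ ω, X ω ^ 4 ∂μ) + 6 * (∫ ω, X ω ^ 2 * Y ω ^ 2 ∂μ) + 3 * ∫ ω, Y ω ^ 4 ∂μ := by
  have hXY := ((hX.pow 2).mul (hY.pow 2)).integrable.const_mul 6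
  rw [integral_comp_prodMk_of_indepFun (F := fun a => (a.1.1 + a.1.2 * a.2) ^ 4)
    (hX.aemeasurable.prodMk hY.aemeasurable) hg h (by fun_prop)
    ((hX.add (hY.mul (.of_hasLaw_gaussianReal hg))).pow 4).integrable]
  simp_rw [integral_add_mul_pow_four_gaussianReal, integral_pow_four_gaussianReal]
  rw [integral_add ((hX.pow 4).integrable.fun_add hXY) ((hY.pow 4).integrable.mul_const 3),
    integral_add (hX.pow 4).integrable hXY, integral_const_mul, integral_mul_const, mul_comm 3]

end Gaussian

section GaussianSums

variable {Ω : Type*} [MeasurableSpace Ω] {μ : Measure Ω} {ι κ : Type*}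

lemma hasLaw_sum_gaussianReal [IsProbabilityMeasure μ] {X : ι → Ω → ℝ} {m : ι → ℝ} {v : ι → NNReal}
    (hX : ∀ i, HasLaw (X i) (gaussianReal (m i) (v i)) μ) (hindep : iIndepFun X μ)
    (s : Finset ι) :
    HasLaw (fun ω => ∑ i ∈ s, X i ω) (gaussianReal (∑ i ∈ s, m i) (∑ i ∈ s, v i)) μ := by
  classical
  have hae : ∀ i, AEMeasurable (X i) μ := fun i => (hX i).aemeasurable
  refine ⟨s.aemeasurable_fun_sum fun i _ => hae i, ?_⟩
  induction s using Finset.induction_on with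
  | empty => simp
  | insert i s hi ih =>
    simp_rw [Finset.sum_insert hi]
    refine gaussianReal_add_gaussianReal_of_indepFun ?_ (hX i).map_eq ih
    have hsum := (hindep.indepFun_finsetSum_of_notMem₀ hae hi).symm
    rwa [Finset.sum_fn] at hsum

/-- A family of independent standard Gaussian variables. -/
structure IsStdGaussianFamily (μ : Measure Ω) (W : ι → Ω → ℝ) : Prop where
  measurable : ∀ i, Measurable (W i)
  indep : iIndepFun W μ
  law : ∀ i, HasLaw (W i) (gaussianReal 0 1) μ

namespace IsStdGaussianFamily

variable {W : ι → Ω → ℝ} (hW : IsStdGaussianFamily μ W)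
include hW

lemma hasFiniteMoments (i : ι) : HasFiniteMoments μ (W i) :=
  .of_hasLaw_gaussianReal (hW.law i)

lemma hasFiniteMoments_add_sum_mul [IsFiniteMeasure μ] (b : ℝ) (h : κ → ℝ) (s : Finset κ)
    (f : κ → ι) : HasFiniteMoments μ (fun ω => b + ∑ k ∈ s, h k * W (f k) ω) :=
  (HasFiniteMoments.const b).add (.sum fun _ _ => (hW.hasFiniteMoments _).const_mul _)

lemma integral_pow (i : ι) (k : ℕ) :
    ∫ ω, W i ω ^ k ∂μ = ∫ z, z ^ k ∂(gaussianReal 0 1) :=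
  (hW.law i).integral_comp (f := fun z : ℝ => z ^ k) (by fun_prop)

variable [IsProbabilityMeasure μ]

lemma hasLaw_sum_mul {s : Finset κ} {f : κ → ι} (hf : Set.InjOn f s) (h : κ → ℝ) :
    HasLaw (fun ω => ∑ k ∈ s, h k * W (f k) ω) (gaussianReal 0 (∑ k ∈ s, ‖h k‖₊ ^ 2)) μ := by
  have hindep : iIndepFun (fun (k : s) ω => h k * W (f k) ω) μ :=
    (hW.indep.precomp (g := fun k : s => f k) hf.injective).comp (fun k z => h k * z)
      fun k => by fun_prop
  have hlaw (k : s) : HasLaw (fun ω => h k * W (f k) ω) (gaussianReal 0 (‖h k‖₊ ^ 2)) μ := by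
    have hmul := gaussianReal_const_mul (hW.law (f k)) (h k)
    rw [mul_zero, mul_one] at hmul
    convert hmul using 2
    ext
    simp
  have hsum := hasLaw_sum_gaussianReal hlaw hindep Finset.univ
  rw [Finset.sum_const_zero, Finset.sum_coe_sort s fun k => ‖h k‖₊ ^ 2] at hsum
  refine hsum.congr (ae_of_all _ fun ω => ?_)
  exact (Finset.sum_coe_sort s fun k => h k * W (f k) ω).symm

lemma integral_add_sum_mul_pow_two {s : Finset κ} {f : κ → ι} (hf : Set.InjOn f s) (b : ℝ)
    (h : κ → ℝ) :
    ∫ ω, (b + ∑ k ∈ s, h k * W (f k) ω) ^ 2 ∂μ = b ^ 2 + ∑ k ∈ s, h k ^ 2 := by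
  simp [integral_const_add_gaussian_pow_two (hW.hasLaw_sum_mul hf h)]

lemma integral_add_sum_mul_pow_four_le {s : Finset κ} {f : κ → ι} (hf : Set.InjOn f s) (b : ℝ)
    (h : κ → ℝ) :
    ∫ ω, (b + ∑ k ∈ s, h k * W (f k) ω) ^ 4 ∂μ ≤ 3 * (b ^ 2 + ∑ k ∈ s, h k ^ 2) ^ 2 := by
  rw [integral_const_add_gaussian_pow_four (hW.hasLaw_sum_mul hf h)]
  push_cast
  simp only [Real.norm_eq_abs, sq_abs]
  nlinarith [sq_nonneg (b ^ 2)]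

end IsStdGaussianFamily

end GaussianSums

section WhiteNoise

variable {Ω : Type*} [mΩ : MeasurableSpace Ω] {μ : Measure Ω} {ι : Type*} [LinearOrder ι]

/-- Standard Gaussian white noise `g` for `ℱ`. The `σ`-algebra `ℱ t` stands for the information
available just before `g t` is drawn, so a process adapted to `ℱ` is predictable. -/
structure IsWhiteNoise (ℱ : Filtration ι mΩ) (g : ι → Ω → ℝ) (μ : Measure Ω) : Prop where
  measurable_of_lt : ∀ ⦃s t⦄, s < t → Measurable[ℱ t] (g s)
  indep : ∀ t, Indep (ℱ t) (MeasurableSpace.comap (g t) inferInstance) μ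
  law : ∀ t, HasLaw (g t) (gaussianReal 0 1) μ

namespace IsWhiteNoise

variable {ℱ : Filtration ι mΩ} {g ξ : ι → Ω → ℝ} {s : Finset ι} (hg : IsWhiteNoise ℱ g μ)
include hg

lemma indepFun_prodMk {t : ι} (hξ : ∀ r ∈ insert t s, Measurable[ℱ r] (ξ r))
    (hs : ∀ r ∈ s, r < t) :
    IndepFun (fun ω => (∑ r ∈ s, ξ r ω * g r ω, ξ t ω)) (g t) μ := by
  have hmeas : Measurable[ℱ t] (fun ω => (∑ r ∈ s, ξ r ω * g r ω, ξ t ω)) :=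
    (Finset.measurable_fun_sum s fun r hr =>
      ((hξ r (Finset.mem_insert_of_mem hr)).mono (ℱ.mono (hs r hr).le) le_rfl).mul
        (hg.measurable_of_lt (hs r hr))).prodMk (hξ t (Finset.mem_insert_self t s))
  exact indep_of_indep_of_le_left (hg.indep t) hmeas.comap_le

variable (hξm : ∀ t, HasFiniteMoments μ (ξ t))
include hξm

lemma hasFiniteMoments_sum (s : Finset ι) :
    HasFiniteMoments μ (fun ω => ∑ t ∈ s, ξ t ω * g t ω) :=
  .sum fun t _ => (hξm t).mul (.of_hasLaw_gaussianReal (hg.law t))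

variable [IsProbabilityMeasure μ]

lemma integral_sum_mul_pow_two (hξ : ∀ t ∈ s, Measurable[ℱ t] (ξ t)) :
    ∫ ω, (∑ t ∈ s, ξ t ω * g t ω) ^ 2 ∂μ = ∑ t ∈ s, ∫ ω, ξ t ω ^ 2 ∂μ := by
  induction s using Finset.induction_on_max with
  | empty => simp
  | insert t s hs ih =>
    have ht : t ∉ s := fun h => (hs t h).false
    simp_rw [Finset.sum_insert ht, add_comm (ξ t _ * g t _)]
    rw [integral_add_mul_gaussian_pow_two (hg.hasFiniteMoments_sum hξm s) (hξm t) (hg.law t)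
      (hg.indepFun_prodMk hξ hs), ih fun r hr => hξ r (Finset.mem_insert_of_mem hr), add_comm]

/- The cross term of the induction step is controlled by Cauchy–Schwarz:
`E[S² ξ²] ≤ √(E[S⁴] E[ξ⁴]) ≤ 3 K E[S²] E[ξ²]`, which is where the factor `9` comes from. -/
lemma integral_sum_mul_pow_four_le (hξ : ∀ t ∈ s, Measurable[ℱ t] (ξ t)) {K : ℝ} (hK : 0 ≤ K)
    (hξ4 : ∀ t, ∫ ω, ξ t ω ^ 4 ∂μ ≤ K * (∫ ω, ξ t ω ^ 2 ∂μ) ^ 2) :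
    ∫ ω, (∑ t ∈ s, ξ t ω * g t ω) ^ 4 ∂μ ≤ 9 * K * (∑ t ∈ s, ∫ ω, ξ t ω ^ 2 ∂μ) ^ 2 := by
  induction s using Finset.induction_on_max with
  | empty => simp
  | insert t s hs ih =>
    have ht : t ∉ s := fun h => (hs t h).false
    specialize ih fun r hr => hξ r (Finset.mem_insert_of_mem hr)
    have hSm := hg.hasFiniteMoments_sum hξm s
    simp_rw [Finset.sum_insert ht, add_comm (ξ t _ * g t _)]
    rw [integral_add_mul_gaussian_pow_four hSm (hξm t) (hg.law t) (hg.indepFun_prodMk hξ hs)]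
    have hcs := sq_integral_mul_le (hSm.pow 2).memLp_two ((hξm t).pow 2).memLp_two
    simp_rw [← pow_mul, Nat.reduceMul] at hcs
    set v := ∫ ω, ξ t ω ^ 2 ∂μ
    set V := ∑ r ∈ s, ∫ ω, ξ r ω ^ 2 ∂μ
    have : 0 ≤ v := integral_nonneg fun ω => sq_nonneg _
    have : 0 ≤ V := Finset.sum_nonneg fun r _ => integral_nonneg fun ω => sq_nonneg _
    have hcross : ∫ ω, (∑ r ∈ s, ξ r ω * g r ω) ^ 2 * ξ t ω ^ 2 ∂μ ≤ 3 * K * (V * v) := by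
      refine le_of_sq_le_sq (hcs.trans ?_) (by positivity)
      calc (∫ ω, (∑ r ∈ s, ξ r ω * g r ω) ^ 4 ∂μ) * ∫ ω, ξ t ω ^ 4 ∂μ
          ≤ (9 * K * V ^ 2) * (K * v ^ 2) :=
            mul_le_mul ih (hξ4 t) (integral_nonneg fun ω => by positivity) (by positivity)
        _ = (3 * K * (V * v)) ^ 2 := by ring
    nlinarith [hξ4 t, mul_nonneg hK (sq_nonneg v)]

end IsWhiteNoise

end WhiteNoise

section GaussianInputs

variable {Ω : Type*} [mΩ : MeasurableSpace Ω] {μ : Measure Ω}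

lemma IsGaussianInput.exists_isStdGaussianFamily {p : ℕ} {u : ℕ → Ω → Fin p → ℝ}
    (hu : IsGaussianInput μ u) [IsProbabilityMeasure μ] :
    ∃ W : ℕ × Fin p → Ω → ℝ, IsStdGaussianFamily μ W ∧
      ∀ᵐ ω ∂μ, ∀ r l, u (r + 1) ω l = W (r, l) ω := by
  have hlaw (r : ℕ) := hu.law (r + 1) r.succ_pos
  have hae (r : ℕ) : AEMeasurable (u (r + 1)) μ := (hlaw r).aemeasurable
  set v : ℕ → Ω → Fin p → ℝ := fun r => (hae r).mk
  have hvm (r : ℕ) : Measurable (v r) := (hae r).measurable_mk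
  have huv (r : ℕ) : u (r + 1) =ᵐ[μ] v r := (hae r).ae_eq_mk
  have hvlaw (r : ℕ) := (hlaw r).congr (huv r).symm
  have hcoord (r : ℕ) (l : Fin p) : HasLaw (fun ω => v r ω l) (gaussianReal 0 1) μ :=
    (measurePreserving_eval (fun _ : Fin p => gaussianReal 0 1) l).fun_comp_hasLaw (hvlaw r)
  refine ⟨fun q ω => v q.1 ω q.2, ⟨fun q => (measurable_pi_apply q.2).comp (hvm q.1), ?_,
    fun q => hcoord q.1 q.2⟩, ?_⟩
  · refine iIndepFun_uncurry' (X := fun r l ω => v r ω l)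
      (fun r l => (measurable_pi_apply l).comp (hvm r)) (hu.indep.congr huv) fun r => ?_
    rw [iIndepFun_iff_map_fun_eq_pi_map fun l => (hcoord r l).aemeasurable]
    simp_rw [fun l => (hcoord r l).map_eq]
    exact (hvlaw r).map_eq
  · filter_upwards [ae_all_iff.2 huv] with ω hω r l
    rw [hω r]

namespace IsStdGaussianFamily

section Past

variable {ι κ : Type*} [LinearOrder ι] {W : ι × κ → Ω → ℝ} (hW : IsStdGaussianFamily μ W)

/-- The information available just before `W (t, l₀)` is drawn, when the variables `W (t, l)` are
drawn in the order of the times `t` and, at each time, the channel `l₀` comes last. -/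
def past (l₀ : κ) : Filtration ι mΩ where
  seq t := ⨆ q ∈ {q : ι × κ | q.1 < t ∨ q.1 = t ∧ q.2 ≠ l₀},
    MeasurableSpace.comap (W q) inferInstance
  mono' s _ hst := biSup_mono fun q (hq : q.1 < s ∨ _) =>
    hq.elim (fun h => .inl (h.trans_le hst))
      fun h => hst.lt_or_eq.imp (h.1.trans_lt ·) fun hst => ⟨h.1.trans hst, h.2⟩
  le' _ := iSup₂_le fun q _ => (hW.measurable q).comap_le

lemma measurable_past {l₀ : κ} {t : ι} {q : ι × κ} (hq : q.1 < t ∨ q.1 = t ∧ q.2 ≠ l₀) :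
    Measurable[hW.past l₀ t] (W q) :=
  (comap_measurable (W q)).mono
    (le_iSup₂_of_le (f := fun q (_ : q ∈ {q : ι × κ | q.1 < t ∨ q.1 = t ∧ q.2 ≠ l₀}) =>
      MeasurableSpace.comap (W q) inferInstance) q hq le_rfl) le_rfl

lemma isWhiteNoise (l₀ : κ) : IsWhiteNoise (hW.past l₀) (fun t => W (t, l₀)) μ where
  measurable_of_lt _ _ hst := hW.measurable_past (.inl hst)
  indep t := by
    have hdisj : Disjoint {q : ι × κ | q.1 < t ∨ q.1 = t ∧ q.2 ≠ l₀} {(t, l₀)} := by simp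
    have hindep := indep_iSup_of_disjoint (fun q => (hW.measurable q).comap_le)
      ((iIndepFun_iff_iIndep _ _ _).1 hW.indep) hdisj
    rwa [iSup_singleton] at hindep
  law t := hW.law (t, l₀)

include hW

variable {η : Type*} {b : ι → ℝ} {h : ι → η → ℝ} {S : ι → Finset η} {f : ι → η → ι × κ}
  (hf : ∀ t, Set.InjOn (f t) (S t)) (hpast : ∀ t, ∀ k ∈ S t, (f t k).1 < t)

include hpast in
lemma measurable_past_add_sum_mul (l₀ : κ) (t : ι) :
    Measurable[hW.past l₀ t] (fun ω => b t + ∑ k ∈ S t, h t k * W (f t k) ω) :=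
  (Finset.measurable_fun_sum _ fun k hk =>
    (hW.measurable_past (.inl (hpast t k hk))).const_mul _).const_add _

include hf hpast

variable [IsProbabilityMeasure μ]

lemma integral_correlation_pow_two (l₀ : κ) (s : Finset ι) :
    ∫ ω, (∑ t ∈ s, (b t + ∑ k ∈ S t, h t k * W (f t k) ω) * W (t, l₀) ω) ^ 2 ∂μ =
      ∑ t ∈ s, (b t ^ 2 + ∑ k ∈ S t, h t k ^ 2) := by
  rw [(hW.isWhiteNoise l₀).integral_sum_mul_pow_two
    (fun t => hW.hasFiniteMoments_add_sum_mul _ _ _ _)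
    fun t _ => hW.measurable_past_add_sum_mul hpast l₀ t]
  exact Finset.sum_congr rfl fun t _ => hW.integral_add_sum_mul_pow_two (hf t) _ _

lemma integral_correlation_pow_four_le (l₀ : κ) (s : Finset ι) :
    ∫ ω, (∑ t ∈ s, (b t + ∑ k ∈ S t, h t k * W (f t k) ω) * W (t, l₀) ω) ^ 4 ∂μ ≤
      27 * (∑ t ∈ s, (b t ^ 2 + ∑ k ∈ S t, h t k ^ 2)) ^ 2 := by
  have hfour := (hW.isWhiteNoise l₀).integral_sum_mul_pow_four_le
    (ξ := fun t ω => b t + ∑ k ∈ S t, h t k * W (f t k) ω) (K := 3)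
    (s := s) (fun t => hW.hasFiniteMoments_add_sum_mul _ _ _ _)
    (fun t _ => hW.measurable_past_add_sum_mul hpast l₀ t) (by norm_num) fun t => by
      rw [hW.integral_add_sum_mul_pow_two (hf t)]
      exact hW.integral_add_sum_mul_pow_four_le (hf t) _ _
  simp_rw [fun t => hW.integral_add_sum_mul_pow_two (hf t)] at hfour
  norm_num at hfour
  exact hfour

/- Conditionally on the past, `∑ ξ_t W_t` is a martingale transform with predictable `ξ`, so its
kurtosis is bounded and Paley–Zygmund applies. -/
lemma le_measureReal_half_energy_le_correlation_sq (l₀ : κ) {s : Finset ι}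
    (hpos : 0 < ∑ t ∈ s, ∑ k ∈ S t, h t k ^ 2) :
    1 / 108 ≤ μ.real {ω | 1 / 2 * ∑ t ∈ s, ∑ k ∈ S t, h t k ^ 2 ≤
      (∑ t ∈ s, (b t + ∑ k ∈ S t, h t k * W (f t k) ω) * W (t, l₀) ω) ^ 2} := by
  have htwo := hW.integral_correlation_pow_two (b := b) (h := h) hf hpast l₀ s
  have henergy : ∑ t ∈ s, ∑ k ∈ S t, h t k ^ 2 ≤ ∑ t ∈ s, (b t ^ 2 + ∑ k ∈ S t, h t k ^ 2) :=
    Finset.sum_le_sum fun t _ => le_add_of_nonneg_left (sq_nonneg _)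
  have hmoments : HasFiniteMoments μ
      (fun ω => ∑ t ∈ s, (b t + ∑ k ∈ S t, h t k * W (f t k) ω) * W (t, l₀) ω) :=
    (hW.isWhiteNoise l₀).hasFiniteMoments_sum
      (fun t => hW.hasFiniteMoments_add_sum_mul _ _ _ _) s
  have hprob := le_measureReal_half_integral_sq_le hmoments (κ := 27) (by norm_num)
    (by rw [htwo]; exact hpos.trans_le henergy)
    (by rw [htwo]; exact hW.integral_correlation_pow_four_le hf hpast l₀ s)
  rw [htwo] at hprob
  norm_num at hprob ⊢
  refine hprob.trans (measureReal_mono fun ω hω => ?_)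
  exact (mul_le_mul_of_nonneg_left henergy (by norm_num)).trans hω

end Past

variable [IsProbabilityMeasure μ] {p : ℕ} {W : ℕ × Fin p → Ω → ℝ} (hW : IsStdGaussianFamily μ W)
include hW

lemma hasFiniteMoments_sum_mul_pow {η : Type*} (s : Finset η) (f g : η → ℕ × Fin p) (k : ℕ) :
    HasFiniteMoments μ (fun ω => (∑ t ∈ s, W (f t) ω * W (g t) ω) ^ k) :=
  (HasFiniteMoments.sum fun _ _ => (hW.hasFiniteMoments _).mul (hW.hasFiniteMoments _)).pow k

lemma integral_gram_offDiag_pow_two {T : ℕ} {l₀ : Fin p} {q : Fin T × Fin p} {s : Finset ℕ}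
    (hs : ∀ t ∈ s, T ≤ t + 1) (hq : ¬ ((q.1 : ℕ) = 0 ∧ q.2 = l₀)) :
    ∫ ω, (∑ t ∈ s, W (t - q.1, q.2) ω * W (t, l₀) ω) ^ 2 ∂μ = s.card := by
  have hpast (t : ℕ) (ht : t ∈ s) : t - q.1 < t ∨ t - q.1 = t ∧ q.2 ≠ l₀ := by
    have := hs t ht
    have := q.1.2
    grind
  rw [(hW.isWhiteNoise l₀).integral_sum_mul_pow_two (ξ := fun t => W (t - q.1, q.2))
    (fun _ => hW.hasFiniteMoments _) fun t ht => hW.measurable_past (hpast t ht)]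
  simp [hW.integral_pow, integral_pow_two_gaussianReal]

lemma integral_gram_diag_pow_two_le (s : Finset ℕ) (l₀ : Fin p) :
    ∫ ω, (∑ t ∈ s, W (t, l₀) ω * W (t, l₀) ω) ^ 2 ∂μ ≤ 3 * (s.card : ℝ) ^ 2 := by
  have hfour (t : ℕ) : Integrable (fun ω => W (t, l₀) ω ^ 4) μ :=
    ((hW.hasFiniteMoments _).pow 4).integrable
  calc ∫ ω, (∑ t ∈ s, W (t, l₀) ω * W (t, l₀) ω) ^ 2 ∂μ
      ≤ ∫ ω, s.card * ∑ t ∈ s, W (t, l₀) ω ^ 4 ∂μ := by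
        refine integral_mono (hW.hasFiniteMoments_sum_mul_pow _ _ _ _).integrable
          ((integrable_finsetSum s fun t _ => hfour t).const_mul _) fun ω => ?_
        refine sq_sum_le_card_mul_sum_sq.trans_eq ?_
        ring_nf
    _ = 3 * (s.card : ℝ) ^ 2 := by
        rw [integral_const_mul, integral_finsetSum s fun t _ => hfour t]
        simp only [hW.integral_pow, integral_pow_four_gaussianReal, Finset.sum_const, nsmul_eq_mul]
        ring

lemma integral_gram_column_sq_le {T : ℕ} {s : Finset ℕ} (hs : ∀ t ∈ s, T ≤ t + 1)
    (l₀ : Fin p) :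
    ∫ ω, ∑ q : Fin T × Fin p, (∑ t ∈ s, W (t - q.1, q.2) ω * W (t, l₀) ω) ^ 2 ∂μ ≤
      3 * (s.card : ℝ) ^ 2 + T * p * s.card := by
  rw [integral_finsetSum _ fun q _ => (hW.hasFiniteMoments_sum_mul_pow _ _ _ _).integrable]
  have hentry (q : Fin T × Fin p) :
      ∫ ω, (∑ t ∈ s, W (t - q.1, q.2) ω * W (t, l₀) ω) ^ 2 ∂μ ≤
        (if (q.1 : ℕ) = 0 ∧ q.2 = l₀ then 3 * (s.card : ℝ) ^ 2 else 0) + s.card := by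
    split_ifs with hq
    · simp only [hq.1, hq.2, Nat.sub_zero]
      exact (hW.integral_gram_diag_pow_two_le s l₀).trans
        (le_add_of_nonneg_right (Nat.cast_nonneg _))
    · rw [hW.integral_gram_offDiag_pow_two hs hq, zero_add]
  have hone : (Finset.univ.filter fun q : Fin T × Fin p => (q.1 : ℕ) = 0 ∧ q.2 = l₀).card ≤ 1 :=
    Finset.card_le_one.2 fun q hq q' hq' => by grind
  refine (Finset.sum_le_sum fun q _ => hentry q).trans ?_
  rw [Finset.sum_add_distrib, ← Finset.sum_filter, Finset.sum_const, Finset.sum_const,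
    nsmul_eq_mul, nsmul_eq_mul, Finset.card_univ, Fintype.card_prod, Fintype.card_fin,
    Fintype.card_fin, Nat.cast_mul]
  exact add_le_add_left (mul_le_of_le_one_left (by positivity) (mod_cast hone)) _

end IsStdGaussianFamily

end GaussianInputs

section MatrixNorm

variable {ι κ 𝕜 : Type*} [Fintype ι] [Fintype κ] [DecidableEq κ] [RCLike 𝕜]

lemma norm_sq_mulVec_apply_le (M : Matrix ι κ 𝕜) (v : κ → 𝕜) (i : ι) :
    ‖(M *ᵥ v) i‖ ^ 2 ≤ ‖M‖ ^ 2 * ∑ k, ‖v k‖ ^ 2 := by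
  have hop := M.l2_opNorm_mulVec (WithLp.toLp 2 v)
  have hcoord := PiLp.norm_apply_le (WithLp.toLp 2 (M *ᵥ v)) i
  rw [← EuclideanSpace.norm_sq_eq (WithLp.toLp 2 v), ← mul_pow]
  exact pow_le_pow_left₀ (norm_nonneg _) (hcoord.trans hop) 2

lemma norm_entry_le_l2_opNorm (M : Matrix ι κ 𝕜) (i : ι) (k : κ) : ‖M i k‖ ≤ ‖M‖ := by
  have hcol := norm_sq_mulVec_apply_le M (Pi.single k 1) i
  simp only [Matrix.mulVec_single_one, Matrix.col_apply, Pi.single_apply, apply_ite norm, norm_one,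
    norm_zero, ite_pow, one_pow, zero_pow two_ne_zero, Finset.sum_ite_eq', Finset.mem_univ,
    if_true, mul_one] at hcol
  exact le_of_sq_le_sq hcol (norm_nonneg _)

lemma l2_opNorm_sq_le_sum_sq (M : Matrix ι κ 𝕜) : ‖M‖ ^ 2 ≤ ∑ i, ∑ k, ‖M i k‖ ^ 2 := by
  have hS : 0 ≤ ∑ i, ∑ k, ‖M i k‖ ^ 2 := by positivity
  rw [← Real.le_sqrt (norm_nonneg M) hS, Matrix.l2_opNorm_def]
  refine ContinuousLinearMap.opNorm_le_bound _ (Real.sqrt_nonneg _) fun v => ?_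
  refine le_of_sq_le_sq ?_ (by positivity)
  rw [mul_pow, Real.sq_sqrt hS, EuclideanSpace.norm_sq_eq, EuclideanSpace.norm_sq_eq,
    Finset.sum_mul]
  refine Finset.sum_le_sum fun i _ => ?_
  calc ‖∑ k, M i k * v k‖ ^ 2 ≤ (∑ k, ‖M i k‖ * ‖v k‖) ^ 2 := by
        gcongr
        exact (norm_sum_le _ _).trans_eq (by simp_rw [norm_mul])
    _ ≤ (∑ k, ‖M i k‖ ^ 2) * ∑ k, ‖v k‖ ^ 2 := Finset.sum_mul_sq_le_sq_mul_sq _ _ _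

end MatrixNorm

section BinomialGrowth

/-- The powers of `a` grow at least like the binomial coefficients `r.choose d`, as those of a
Jordan block of size `d + 1` with an eigenvalue on the unit circle do. -/
def HasBinomialGrowth {𝓐 : Type*} [NormedRing 𝓐] (a : 𝓐) (d : ℕ) : Prop :=
  ∃ c : ℝ, 0 < c ∧ ∀ r : ℕ, c * (r.choose d : ℝ) ≤ ‖a ^ r‖

lemma HasBinomialGrowth.units_conj {𝓐 : Type*} [NormedRing 𝓐] {a : 𝓐} {d : ℕ}
    (h : HasBinomialGrowth a d) (u : 𝓐ˣ) : HasBinomialGrowth (u * a * ↑u⁻¹) d := by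
  obtain ⟨c, hc, hr⟩ := h
  refine ⟨c / (‖(↑u⁻¹ : 𝓐)‖ * ‖(u : 𝓐)‖ + 1), by positivity, fun r => ?_⟩
  have hpow : a ^ r = ↑u⁻¹ * (u * a * ↑u⁻¹) ^ r * u := by
    rw [Units.conj_pow]
    simp [mul_assoc]
  rw [div_mul_eq_mul_div, div_le_iff₀ (by positivity)]
  calc c * (r.choose d : ℝ) ≤ ‖a ^ r‖ := hr r
    _ ≤ ‖(↑u⁻¹ : 𝓐)‖ * ‖(u * a * ↑u⁻¹) ^ r‖ * ‖(u : 𝓐)‖ := hpow ▸ norm_mul₃_le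
    _ ≤ ‖(u * a * ↑u⁻¹) ^ r‖ * (‖(↑u⁻¹ : 𝓐)‖ * ‖(u : 𝓐)‖ + 1) := by
      nlinarith [norm_nonneg ((u * a * ↑u⁻¹) ^ r)]

lemma hasBinomialGrowth_zero_of_one_le_spectralRadius {𝓐 : Type*} [NormedRing 𝓐]
    [NormedAlgebra ℂ 𝓐] [CompleteSpace 𝓐] [NormOneClass 𝓐] {a : 𝓐}
    (h : 1 ≤ spectralRadius ℂ a) : HasBinomialGrowth a 0 := by
  have : Nontrivial 𝓐 := NormOneClass.nontrivial
  refine ⟨1, one_pos, fun r => ?_⟩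
  have hpow : (1 : ENNReal) ≤ ‖a ^ r‖₊ := (one_le_pow_of_one_le' h r).trans
    ((spectrum.spectralRadius_pow_le' a r).trans (spectrum.spectralRadius_le_nnnorm _))
  rw [Nat.choose_zero_right, Nat.cast_one, one_mul]
  exact_mod_cast hpow

/-- The nilpotent part of a Jordan block. -/
def shift (k : ℕ) : Matrix (Fin k) (Fin k) ℂ :=
  Matrix.of fun i j => if i.val + 1 = j.val then 1 else 0

lemma shift_pow_apply (k q : ℕ) (i j : Fin k) :
    (shift k ^ q) i j = if i.val + q = j.val then 1 else 0 := by
  induction q generalizing i with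
  | zero => simp [Matrix.one_apply, Fin.ext_iff]
  | succ q ih =>
    have hshift (l : Fin k) : shift k i l = if i.val + 1 = l.val then 1 else 0 := rfl
    simp only [pow_succ', Matrix.mul_apply, hshift, ite_mul, one_mul, zero_mul]
    by_cases hi : i.val + 1 < k
    · rw [Finset.sum_eq_single ⟨i.val + 1, hi⟩ (fun l _ hl => if_neg fun e => hl (Fin.ext e.symm))
        (by simp), if_pos rfl, ih]
      grind
    · rw [if_neg (by omega)]
      exact Finset.sum_eq_zero fun l _ => if_neg (by omega)

lemma jordanBlock_eq_shift_add (ev : ℂ) (k : ℕ) :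
    jordanBlock ev k = shift k + algebraMap ℂ _ ev := by
  ext i j
  simp only [jordanBlock, shift, Matrix.of_apply, Matrix.add_apply, Matrix.algebraMap_matrix_apply,
    Algebra.algebraMap_self, RingHom.id_apply]
  grind

lemma jordanBlock_pow_apply (ev : ℂ) {k : ℕ} (r q : ℕ) {i j : Fin k} (hij : i.val + q = j.val) :
    (jordanBlock ev k ^ r) i j = ev ^ (r - q) * r.choose q := by
  rw [jordanBlock_eq_shift_add, (Algebra.commute_algebraMap_right ev (shift k)).add_pow,
    Matrix.sum_apply]
  simp_rw [← map_pow, mul_assoc, ← map_natCast (algebraMap ℂ (Matrix (Fin k) (Fin k) ℂ)),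
    ← map_mul, ← Algebra.commutes, ← Algebra.smul_def, Matrix.smul_apply, shift_pow_apply]
  simp only [← hij, add_right_inj, smul_eq_mul, mul_ite, mul_one, mul_zero, Finset.sum_ite_eq',
    Finset.mem_range]
  split_ifs with hq
  · rfl
  · simp [Nat.choose_eq_zero_of_lt (by omega : r < q)]

lemma hasBinomialGrowth_reindex_blockDiagonal' {α : Type*} [Fintype α] [DecidableEq α] {r : ℕ}
    {size : Fin r → ℕ} (eig : Fin r → ℂ) (e : (Σ i, Fin (size i)) ≃ α) {i : Fin r}
    (hsize : 1 ≤ size i) (hev : 1 ≤ ‖eig i‖) :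
    HasBinomialGrowth (Matrix.reindex e e
      (Matrix.blockDiagonal' fun i => jordanBlock (eig i) (size i))) (size i - 1) := by
  refine ⟨1, one_pos, fun q => ?_⟩
  let first : Fin (size i) := ⟨0, by omega⟩
  let last : Fin (size i) := ⟨size i - 1, by omega⟩
  have hpow : (Matrix.reindex e e (Matrix.blockDiagonal' fun i => jordanBlock (eig i) (size i)) ^ q)
      (e ⟨i, first⟩) (e ⟨i, last⟩) = (jordanBlock (eig i) (size i) ^ q) first last := by
    rw [← Matrix.coe_reindexAlgEquiv ℂ ℂ, ← map_pow, ← Matrix.blockDiagonal'_pow,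
      Matrix.coe_reindexAlgEquiv, Matrix.reindex_apply, Matrix.submatrix_apply,
      e.symm_apply_apply, e.symm_apply_apply, Matrix.blockDiagonal'_apply_eq,
      Pi.pow_apply]
  calc 1 * (q.choose (size i - 1) : ℝ)
      ≤ ‖eig i‖ ^ (q - (size i - 1)) * (q.choose (size i - 1) : ℝ) := by
        gcongr
        exact one_le_pow₀ hev
    _ = ‖(jordanBlock (eig i) (size i) ^ q) first last‖ := by
        rw [jordanBlock_pow_apply (eig i) q (size i - 1) (by simp [first, last])]
        simp
    _ ≤ _ := hpow ▸ norm_entry_le_l2_opNorm _ _ _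

lemma HasJordanBlock.hasBinomialGrowth {n k : ℕ} {A : Matrix (Fin n) (Fin n) ℝ} {ev : ℂ}
    (h : HasJordanBlock A ev k) (hev : 1 ≤ ‖ev‖) :
    HasBinomialGrowth (A.map fun a : ℝ => (a : ℂ)) (k - 1) := by
  obtain ⟨r, size, eig, e, S, hsize, ⟨u, rfl⟩, hA, i, rfl, rfl⟩ := h
  rw [hA, ← Matrix.coe_units_inv]
  exact (hasBinomialGrowth_reindex_blockDiagonal' eig e (hsize i) hev).units_conj u

end BinomialGrowth

section PolynomialGrowth

lemma eventually_mul_pow_succ_le_sum_Ico {g : ℕ → ℝ} (hg : 0 ≤ g) {c : ℝ} (hc : 0 ≤ c) {k : ℕ}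
    (hgrowth : ∀ᶠ t : ℕ in atTop, c * (t : ℝ) ^ k ≤ g t) :
    ∀ᶠ N : ℕ in atTop, ∀ a, 2 * a ≤ N →
      c / 4 ^ (k + 1) * (N : ℝ) ^ (k + 1) ≤ ∑ t ∈ Finset.Ico a N, g t := by
  obtain ⟨t₀, ht₀⟩ := eventually_atTop.1 hgrowth
  filter_upwards [eventually_ge_atTop (2 * t₀ + 2)] with N hN a ha
  have hcard : (N : ℝ) / 4 ≤ (Finset.Ico ((N + 1) / 2) N).card := by
    rw [Nat.card_Ico, div_le_iff₀ (by norm_num)]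
    exact_mod_cast (by omega : N ≤ (N - (N + 1) / 2) * 4)
  have hterm : ∀ t ∈ Finset.Ico ((N + 1) / 2) N, c * ((N : ℝ) / 4) ^ k ≤ g t := fun t ht => by
    rw [Finset.mem_Ico] at ht
    refine le_trans ?_ (ht₀ t (by omega))
    gcongr
    rw [div_le_iff₀ (by norm_num)]
    exact_mod_cast (by omega : N ≤ t * 4)
  calc c / 4 ^ (k + 1) * (N : ℝ) ^ (k + 1) = (N : ℝ) / 4 * (c * ((N : ℝ) / 4) ^ k) := by
        rw [div_pow, pow_succ (4 : ℝ)]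
        field_simp
        ring
    _ ≤ (Finset.Ico ((N + 1) / 2) N).card * (c * ((N : ℝ) / 4) ^ k) := by gcongr
    _ ≤ ∑ t ∈ Finset.Ico ((N + 1) / 2) N, g t := by
        rw [← nsmul_eq_mul]
        exact Finset.card_nsmul_le_sum _ _ _ hterm
    _ ≤ ∑ t ∈ Finset.Ico a N, g t :=
        Finset.sum_le_sum_of_subset_of_nonneg (Finset.Ico_subset_Ico_left (by omega))
          fun t _ _ => hg t

lemma eventually_pow_le_choose (d : ℕ) :
    ∀ᶠ r : ℕ in atTop, (r : ℝ) ^ d / (2 ^ d * d.factorial) ≤ r.choose d := by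
  filter_upwards [eventually_ge_atTop (2 * d)] with r hr
  refine le_trans ?_ (Nat.pow_le_choose (α := ℝ) d r)
  rw [← div_div, ← div_pow]
  gcongr
  rw [div_le_iff₀ two_pos]
  exact_mod_cast (by omega : r ≤ (r + 1 - d) * 2)

end PolynomialGrowth

section Markov

lemma exists_mul_eq_one_of_rank_eq_card {ι κ : Type*} [Fintype ι] [DecidableEq ι]
    [Fintype κ] {M : Matrix ι κ ℝ} (h : M.rank = Fintype.card ι) :
    ∃ R : Matrix κ ι ℝ, M * R = 1 := by
  rw [← Matrix.mulVec_surjective_iff_exists_right_inverse, ← Matrix.coe_mulVecLin,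
    ← LinearMap.range_eq_top]
  exact Submodule.eq_top_of_finrank_eq (by rw [← Matrix.rank, h, Module.finrank_pi])

variable {n m p : ℕ} (A : Matrix (Fin n) (Fin n) ℝ) (B : Matrix (Fin n) (Fin p) ℝ)
  (C : Matrix (Fin m) (Fin n) ℝ)

/-- The energy (squared Frobenius norm) of the Markov parameter `C A ^ r B`. -/
def markovEnergy (r : ℕ) : ℝ :=
  ∑ i, ∑ l, (C * A ^ r * B) i l ^ 2

lemma markovEnergy_nonneg (r : ℕ) : 0 ≤ markovEnergy A B C r := by
  unfold markovEnergy
  positivity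

lemma observabilityMatrix_mul_pow_mul_controllabilityMatrix_apply (r : ℕ) (j : Fin n × Fin m)
    (k : Fin n × Fin p) :
    (observabilityMatrix A C * A ^ r * controllabilityMatrix A B) j k =
      (C * A ^ (r + (j.1 + k.1)) * B) j.2 k.2 := by
  have hsplit : C * A ^ (r + (j.1 + k.1)) * B =
      C * A ^ (j.1 : ℕ) * A ^ r * (A ^ (k.1 : ℕ) * B) := by
    rw [show r + ((j.1 : ℕ) + k.1) = j.1 + r + k.1 by ring]
    simp only [pow_add, Matrix.mul_assoc]
  rw [hsplit]
  rfl

variable {A B C}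

/- With one-sided inverses `L`, `R` of the observability and controllability matrices `O`, `Q`,
`A ^ r = L (O A ^ r Q) R`, and the entries of `O A ^ r Q` are those of Markov parameters. -/
lemma IsMinimal.exists_mul_choose_sq_le_sum_markovEnergy (hmin : IsMinimal A B C) {d : ℕ}
    (hg : HasBinomialGrowth (A.map fun a : ℝ => (a : ℂ)) d) :
    ∃ c : ℝ, 0 < c ∧ ∀ r : ℕ,
      c * (r.choose d : ℝ) ^ 2 ≤ ∑ i : Fin n, ∑ j : Fin n, markovEnergy A B C (r + (i + j)) := by
  obtain ⟨c, hc, hgrowth⟩ := hg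
  set O := observabilityMatrix A C
  set Q := controllabilityMatrix A B
  obtain ⟨R, hR⟩ := exists_mul_eq_one_of_rank_eq_card (M := Q)
    (by rw [hmin.1, Fintype.card_fin])
  obtain ⟨L, hL⟩ := exists_mul_eq_one_of_rank_eq_card (M := Oᵀ)
    (by rw [Matrix.rank_transpose, hmin.2, Fintype.card_fin])
  have hLO : Lᵀ * O = 1 := by simpa using congrArg Matrix.transpose hL
  let φ : ℝ →+* ℂ := Complex.ofRealHom
  set a := ‖Lᵀ.map φ‖ * ‖R.map φ‖
  refine ⟨c ^ 2 / (a ^ 2 + 1), by positivity, fun r => ?_⟩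
  set H := O * A ^ r * Q with hH
  have hpow : A.map φ ^ r = Lᵀ.map φ * H.map φ * R.map φ := by
    rw [← Matrix.map_pow, ← Matrix.map_mul, ← Matrix.map_mul, hH]
    congr 1
    rw [← Matrix.mul_assoc Lᵀ, ← Matrix.mul_assoc Lᵀ, hLO, Matrix.one_mul, Matrix.mul_assoc, hR,
      Matrix.mul_one]
  have hnorm : c * r.choose d ≤ a * ‖H.map φ‖ :=
    calc c * r.choose d ≤ ‖A.map φ ^ r‖ := hgrowth r
      _ ≤ ‖Lᵀ.map φ‖ * ‖H.map φ‖ * ‖R.map φ‖ :=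
        hpow ▸ (Matrix.l2_opNorm_mul _ _).trans
          (mul_le_mul_of_nonneg_right (Matrix.l2_opNorm_mul _ _) (norm_nonneg _))
      _ = a * ‖H.map φ‖ := by ring
  have hHankel : ‖H.map φ‖ ^ 2 ≤ ∑ i : Fin n, ∑ j : Fin n, markovEnergy A B C (r + (i + j)) := by
    refine (l2_opNorm_sq_le_sum_sq _).trans_eq ?_
    simp only [φ, H, O, Q, Matrix.map_apply, Complex.ofRealHom_eq_coe, Complex.norm_real,
      observabilityMatrix_mul_pow_mul_controllabilityMatrix_apply, Real.norm_eq_abs, sq_abs,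
      Fintype.sum_prod_type, markovEnergy]
    exact Finset.sum_congr rfl fun i _ => Finset.sum_comm
  rw [div_mul_eq_mul_div, div_le_iff₀ (by positivity)]
  calc c ^ 2 * (r.choose d : ℝ) ^ 2 = (c * r.choose d) ^ 2 := by ring
    _ ≤ (a * ‖H.map φ‖) ^ 2 := by gcongr
    _ ≤ ‖H.map φ‖ ^ 2 * (a ^ 2 + 1) := by nlinarith [sq_nonneg ‖H.map φ‖]
    _ ≤ _ := by gcongr

lemma sum_sum_markovEnergy_add_le (a R : ℕ) :
    ∑ r ∈ Finset.Ico a R, ∑ i : Fin n, ∑ j : Fin n, markovEnergy A B C (r + (i + j)) ≤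
      (n : ℝ) ^ 2 * ∑ r ∈ Finset.Ico a (R + 2 * n), markovEnergy A B C r := by
  have hshift (i j : Fin n) : ∑ r ∈ Finset.Ico a R, markovEnergy A B C (r + (i + j)) ≤
      ∑ r ∈ Finset.Ico a (R + 2 * n), markovEnergy A B C r := by
    rw [Finset.sum_Ico_add' (markovEnergy A B C)]
    exact Finset.sum_le_sum_of_subset_of_nonneg (Finset.Ico_subset_Ico (by omega) (by omega))
      fun r _ _ => markovEnergy_nonneg A B C r
  rw [Finset.sum_comm]
  simp_rw [Finset.sum_comm (s := Finset.Ico a R)]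
  refine (Finset.sum_le_sum fun i _ => Finset.sum_le_sum fun j _ => hshift i j).trans_eq ?_
  simp only [Finset.sum_const, Finset.card_univ, Fintype.card_fin, nsmul_eq_mul]
  ring

lemma IsMinimal.exists_mul_pow_le_sum_markovEnergy (hmin : IsMinimal A B C) {d : ℕ}
    (hg : HasBinomialGrowth (A.map fun a : ℝ => (a : ℂ)) d) :
    ∃ c : ℝ, 0 < c ∧ ∀ a : ℕ, ∀ᶠ R : ℕ in atTop,
      c * (R : ℝ) ^ (2 * d + 1) ≤ ∑ r ∈ Finset.Ico a R, markovEnergy A B C r := by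
  obtain ⟨c, hc, hchoose⟩ := hmin.exists_mul_choose_sq_le_sum_markovEnergy hg
  have hpoint : ∀ᶠ r : ℕ in atTop, c / (2 ^ d * d.factorial) ^ 2 * (r : ℝ) ^ (2 * d) ≤
      ∑ i : Fin n, ∑ j : Fin n, markovEnergy A B C (r + (i + j)) := by
    filter_upwards [eventually_pow_le_choose d] with r hr
    refine le_trans ?_ (hchoose r)
    calc c / (2 ^ d * d.factorial) ^ 2 * (r : ℝ) ^ (2 * d)
        = c * ((r : ℝ) ^ d / (2 ^ d * d.factorial)) ^ 2 := by ring
      _ ≤ c * (r.choose d : ℝ) ^ 2 := by gcongr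
  have hsum := eventually_mul_pow_succ_le_sum_Ico
    (g := fun r => ∑ i : Fin n, ∑ j : Fin n, markovEnergy A B C (r + (i + j)))
    (fun r => Finset.sum_nonneg fun i _ => Finset.sum_nonneg fun j _ =>
      markovEnergy_nonneg A B C (r + (i + j))) (by positivity) hpoint
  set c' := c / (2 ^ d * d.factorial) ^ 2 / 4 ^ (2 * d + 1)
  refine ⟨c' / (2 ^ (2 * d + 1) * ((n : ℝ) ^ 2 + 1)), by positivity, fun a => ?_⟩
  filter_upwards [(tendsto_sub_atTop_nat (2 * n)).eventually hsum,
    eventually_ge_atTop (4 * n + 2 * a)] with R hR hRa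
  have hhalf : (R : ℝ) / 2 ≤ (R - 2 * n : ℕ) := by
    rw [div_le_iff₀ two_pos]
    exact_mod_cast (by omega : R ≤ (R - 2 * n) * 2)
  have henergy := (hR a (by omega)).trans (sum_sum_markovEnergy_add_le a (R - 2 * n))
  rw [Nat.sub_add_cancel (by omega)] at henergy
  have hnonneg : 0 ≤ ∑ r ∈ Finset.Ico a R, markovEnergy A B C r :=
    Finset.sum_nonneg fun r _ => markovEnergy_nonneg A B C r
  rw [div_mul_eq_mul_div, div_le_iff₀ (by positivity)]
  calc c' * (R : ℝ) ^ (2 * d + 1)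
      = 2 ^ (2 * d + 1) * (c' * ((R : ℝ) / 2) ^ (2 * d + 1)) := by
        rw [div_pow]
        field_simp
    _ ≤ 2 ^ (2 * d + 1) * (c' * ((R - 2 * n : ℕ) : ℝ) ^ (2 * d + 1)) := by gcongr
    _ ≤ 2 ^ (2 * d + 1) * ((n : ℝ) ^ 2 * ∑ r ∈ Finset.Ico a R, markovEnergy A B C r) := by gcongr
    _ ≤ (∑ r ∈ Finset.Ico a R, markovEnergy A B C r) * (2 ^ (2 * d + 1) * ((n : ℝ) ^ 2 + 1)) := by
        nlinarith [mul_nonneg (pow_nonneg zero_le_two (2 * d + 1)) hnonneg]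

lemma IsMinimal.exists_mul_pow_le_sum_sum_markovEnergy (hmin : IsMinimal A B C) {d : ℕ}
    (hg : HasBinomialGrowth (A.map fun a : ℝ => (a : ℂ)) d) :
    ∃ c : ℝ, 0 < c ∧ ∀ s : ℕ, ∀ᶠ N : ℕ in atTop, ∀ a, 2 * a ≤ N →
      c * (N : ℝ) ^ (2 * d + 2) ≤
        ∑ t ∈ Finset.Ico a N, ∑ r ∈ Finset.Ico s t, markovEnergy A B C r := by
  obtain ⟨c, hc, hsum⟩ := hmin.exists_mul_pow_le_sum_markovEnergy hg
  exact ⟨c / 4 ^ (2 * d + 1 + 1), by positivity, fun s => eventually_mul_pow_succ_le_sum_Ico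
    (fun t => Finset.sum_nonneg fun r _ => markovEnergy_nonneg A B C r) hc.le (hsum s)⟩

end Markov

section LeastSquares

variable {m p T N₁ N : ℕ} {u : ℕ → Fin p → ℝ} {y : ℕ → Fin m → ℝ}
  {G : Matrix (Fin m) (Fin T × Fin p) ℝ}

lemma squaredLoss_add_single (G : Matrix (Fin m) (Fin T × Fin p) ℝ) (i : Fin m)
    (q : Fin T × Fin p) (ε : ℝ) :
    squaredLoss T N₁ N u y (G + Matrix.single i q ε) =
      (∑ t ∈ Finset.Icc N₁ N, concatInput T u t q ^ 2) * (ε * ε) +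
        2 * (∑ t ∈ Finset.Icc N₁ N, (G *ᵥ concatInput T u t - y t) i * concatInput T u t q) * ε +
        squaredLoss T N₁ N u y G := by
  simp only [squaredLoss, Finset.mul_sum, Finset.sum_mul]
  rw [← Finset.sum_add_distrib, ← Finset.sum_add_distrib]
  refine Finset.sum_congr rfl fun t _ => ?_
  have hperturb : WithLp.toLp 2 ((G + Matrix.single i q ε) *ᵥ concatInput T u t - y t) =
      WithLp.toLp 2 (G *ᵥ concatInput T u t - y t) +
        EuclideanSpace.single i (ε * concatInput T u t q) := by
    ext k
    simp only [Matrix.add_mulVec, Matrix.single_mulVec, PiLp.add_apply, PiLp.single_apply,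
      Pi.add_apply, Pi.sub_apply, Function.update_apply, Pi.zero_apply]
    ring
  rw [hperturb, norm_add_sq_real, EuclideanSpace.inner_single_right, PiLp.norm_single,
    Real.norm_eq_abs, sq_abs, conj_trivial]
  ring

lemma IsOLS.sum_residual_mul_concatInput_eq_zero (hG : IsOLS T N₁ N u y G) (i : Fin m)
    (q : Fin T × Fin p) :
    ∑ t ∈ Finset.Icc N₁ N, (G *ᵥ concatInput T u t - y t) i * concatInput T u t q = 0 := by
  have hquad (ε : ℝ) : 0 ≤ (∑ t ∈ Finset.Icc N₁ N, concatInput T u t q ^ 2) * (ε * ε) +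
      2 * (∑ t ∈ Finset.Icc N₁ N, (G *ᵥ concatInput T u t - y t) i * concatInput T u t q) * ε +
      0 := by
    linarith [hG (G + Matrix.single i q ε), squaredLoss_add_single (u := u) (y := y) (N₁ := N₁)
      (N := N) G i q ε]
  have hdiscrim := discrim_le_zero hquad
  rw [discrim, mul_zero, sub_zero] at hdiscrim
  linarith [pow_eq_zero_iff two_ne_zero |>.1 (hdiscrim.antisymm (sq_nonneg _))]

lemma IsOLS.sum_residual_mul_concatInput (hG : IsOLS T N₁ N u y G)
    (G₀ : Matrix (Fin m) (Fin T × Fin p) ℝ) (i : Fin m) (q : Fin T × Fin p) :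
    ∑ t ∈ Finset.Icc N₁ N, (y t - G₀ *ᵥ concatInput T u t) i * concatInput T u t q =
      ((G - G₀) *ᵥ fun q' =>
        ∑ t ∈ Finset.Icc N₁ N, concatInput T u t q' * concatInput T u t q) i := by
  have hgram : ((G - G₀) *ᵥ fun q' =>
      ∑ t ∈ Finset.Icc N₁ N, concatInput T u t q' * concatInput T u t q) i =
      ∑ t ∈ Finset.Icc N₁ N, ((G - G₀) *ᵥ concatInput T u t) i * concatInput T u t q := by
    simp only [Matrix.mulVec, dotProduct, Finset.mul_sum, Finset.sum_mul, ← mul_assoc]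
    exact Finset.sum_comm
  rw [hgram, ← sub_eq_zero, ← neg_eq_zero, ← Finset.sum_sub_distrib, ← Finset.sum_neg_distrib,
    ← hG.sum_residual_mul_concatInput_eq_zero i q]
  refine Finset.sum_congr rfl fun t _ => ?_
  simp only [Matrix.sub_mulVec, Pi.sub_apply]
  ring

lemma IsOLS.sq_sum_residual_mul_concatInput_le (hG : IsOLS T N₁ N u y G)
    (G₀ : Matrix (Fin m) (Fin T × Fin p) ℝ) (i : Fin m) (q : Fin T × Fin p) :
    (∑ t ∈ Finset.Icc N₁ N, (y t - G₀ *ᵥ concatInput T u t) i * concatInput T u t q) ^ 2 ≤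
      ‖G - G₀‖ ^ 2 * ∑ q' : Fin T × Fin p,
        (∑ t ∈ Finset.Icc N₁ N, concatInput T u t q' * concatInput T u t q) ^ 2 := by
  rw [hG.sum_residual_mul_concatInput G₀ i q]
  simpa only [Real.norm_eq_abs, sq_abs] using norm_sq_mulVec_apply_le (G - G₀) (fun q' =>
    ∑ t ∈ Finset.Icc N₁ N, concatInput T u t q' * concatInput T u t q) i

end LeastSquares

section Trajectory

variable {n m p dw dz : ℕ} {A : Matrix (Fin n) (Fin n) ℝ}
  {B : Matrix (Fin n) (Fin p) ℝ} {C : Matrix (Fin m) (Fin n) ℝ} {D : Matrix (Fin m) (Fin p) ℝ}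
  {Bw : Matrix (Fin n) (Fin dw) ℝ} {Dz : Matrix (Fin m) (Fin dz) ℝ} {xinit : Fin n → ℝ}
  {u : ℕ → Fin p → ℝ} {w : ℕ → Fin dw → ℝ} {z : ℕ → Fin dz → ℝ}
  {x : ℕ → Fin n → ℝ} {y : ℕ → Fin m → ℝ}

lemma IsTrajectory.state_succ_eq (h : IsTrajectory A B C D Bw Dz xinit u w z x y) (t : ℕ) :
    x (t + 1) = A ^ t *ᵥ xinit +
      ∑ j ∈ Finset.range t, A ^ j *ᵥ (B *ᵥ u (t - j) + Bw *ᵥ w (t - j)) := by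
  induction t with
  | zero => simp [h.init]
  | succ t ih =>
    rw [h.state (t + 1) (by omega), ih, Finset.sum_range_succ', Matrix.mulVec_add,
      Matrix.mulVec_sum, pow_zero, Matrix.one_mulVec, Nat.sub_zero]
    simp only [Matrix.mulVec_mulVec, ← pow_succ', Nat.add_sub_add_right, add_assoc]

/-- The output at time `t + 1` of the system driven by the disturbances `w`, `z` alone, i.e. with
inputs `u = 0`. -/
def freeOutput (A : Matrix (Fin n) (Fin n) ℝ) (C : Matrix (Fin m) (Fin n) ℝ)
    (Bw : Matrix (Fin n) (Fin dw) ℝ) (Dz : Matrix (Fin m) (Fin dz) ℝ) (xinit : Fin n → ℝ)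
    (w : ℕ → Fin dw → ℝ) (z : ℕ → Fin dz → ℝ) (t : ℕ) : Fin m → ℝ :=
  C *ᵥ (A ^ t *ᵥ xinit + ∑ j ∈ Finset.range t, A ^ j *ᵥ Bw *ᵥ w (t - j)) + Dz *ᵥ z (t + 1)

lemma IsTrajectory.output_succ_eq (h : IsTrajectory A B C D Bw Dz xinit u w z x y) (t : ℕ) :
    y (t + 1) = freeOutput A C Bw Dz xinit w z t + D *ᵥ u (t + 1) +
      ∑ j ∈ Finset.range t, (C * A ^ j * B) *ᵥ u (t - j) := by
  rw [h.output _ (by omega), h.state_succ_eq, freeOutput]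
  simp only [Matrix.mulVec_add, Finset.sum_add_distrib, Matrix.mulVec_sum, Matrix.mulVec_mulVec,
    Matrix.mul_assoc]
  abel

lemma response_mulVec_concatInput (T t : ℕ) :
    response A B C D (T + 1) *ᵥ concatInput (T + 1) u (t + 1) =
      D *ᵥ u (t + 1) + ∑ j ∈ Finset.range T, (C * A ^ j * B) *ᵥ u (t - j) := by
  ext i
  simp only [Matrix.mulVec, dotProduct, Fintype.sum_prod_type, Fin.sum_univ_succ, response,
    concatInput, Matrix.of_apply, Pi.add_apply, Finset.sum_apply, Finset.sum_range, Fin.val_zero,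
    Fin.val_succ, if_true, Nat.add_sub_cancel, Nat.sub_zero, Nat.add_sub_add_right,
    Nat.add_eq_zero_iff, one_ne_zero, and_false, if_false]

lemma IsTrajectory.residual_eq (h : IsTrajectory A B C D Bw Dz xinit u w z x y) {T t : ℕ}
    (hT : 1 ≤ T) (ht : T ≤ t + 1) :
    y (t + 1) - response A B C D T *ᵥ concatInput T u (t + 1) =
      freeOutput A C Bw Dz xinit w z t +
        ∑ j ∈ Finset.Ico (T - 1) t, (C * A ^ j * B) *ᵥ u (t - j) := by
  obtain ⟨T, rfl⟩ := Nat.exists_eq_add_of_le' hT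
  rw [h.output_succ_eq, response_mulVec_concatInput, Nat.add_sub_cancel,
    ← Finset.sum_range_add_sum_Ico _ (Nat.le_of_succ_le_succ ht)]
  abel

end Trajectory

section Probability

variable {Ω : Type*} {mΩ : MeasurableSpace Ω} {μ : Measure Ω} [IsFiniteMeasure μ]

lemma measureReal_le_le_measureReal_le_mul_add {X Y e : Ω → ℝ} (he : 0 ≤ e)
    (h : ∀ᵐ ω ∂μ, X ω ≤ e ω * Y ω) (a b : ℝ) :
    μ.real {ω | a ≤ X ω} ≤ μ.real {ω | a ≤ e ω * b} + μ.real {ω | b ≤ Y ω} := by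
  have hsubset : ∀ᵐ ω ∂μ, a ≤ X ω → a ≤ e ω * b ∨ b ≤ Y ω := by
    filter_upwards [h] with ω hω haX
    refine (le_total (Y ω) b).imp_left fun hY => ?_
    exact haX.trans (hω.trans (mul_le_mul_of_nonneg_left hY (he ω)))
  exact (ENNReal.toReal_mono (measure_ne_top μ _) (measure_mono_ae hsubset)).trans
    (measureReal_union_le _ _)

lemma not_tendstoInMeasure_of_frequently_le_measureReal {ι E : Type*} [SeminormedAddCommGroup E]
    {l : Filter ι} {f : ι → Ω → E} {g : Ω → E} {K c : ℝ} (hK : 0 < K) (hc : 0 < c)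
    (h : ∃ᶠ N in l, c ≤ μ.real {ω | K ≤ ‖f N ω - g ω‖}) : ¬ TendstoInMeasure μ f l g := by
  rw [tendstoInMeasure_iff_measureReal_norm]
  intro hlim
  exact h (((hlim K hK).eventually_lt_const hc).mono fun N hN => hN.not_ge)

end Probability

section LowerBound

variable {n m p dw dz : ℕ} {A : Matrix (Fin n) (Fin n) ℝ}
  {B : Matrix (Fin n) (Fin p) ℝ} {C : Matrix (Fin m) (Fin n) ℝ} {D : Matrix (Fin m) (Fin p) ℝ}
  {Bw : Matrix (Fin n) (Fin dw) ℝ} {Dz : Matrix (Fin m) (Fin dz) ℝ} {xinit : Fin n → ℝ}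
  {w : ℕ → Fin dw → ℝ} {z : ℕ → Fin dz → ℝ} {T a N : ℕ}

lemma IsOLS.sq_correlation_le {u : ℕ → Fin p → ℝ} {x : ℕ → Fin n → ℝ} {y : ℕ → Fin m → ℝ}
    {G : Matrix (Fin m) (Fin T × Fin p) ℝ} (hG : IsOLS T (a + 1) N u y G)
    (h : IsTrajectory A B C D Bw Dz xinit u w z x y) {v : ℕ × Fin p → ℝ}
    (hv : ∀ r l, u (r + 1) l = v (r, l)) (hT : 1 ≤ T) (ha : T ≤ a + 1) (i : Fin m) (l₀ : Fin p) :
    (∑ t ∈ Finset.Ico a N, (freeOutput A C Bw Dz xinit w z t i +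
      ∑ k ∈ Finset.Ico (T - 1) t ×ˢ Finset.univ,
        (C * A ^ k.1 * B) i k.2 * v (t - 1 - k.1, k.2)) * v (t, l₀)) ^ 2 ≤
      ‖G - response A B C D T‖ ^ 2 *
        ∑ q : Fin T × Fin p, (∑ t ∈ Finset.Ico a N, v (t - q.1, q.2) * v (t, l₀)) ^ 2 := by
  have hshift (f : ℕ → ℝ) : ∑ t ∈ Finset.Icc (a + 1) N, f t = ∑ t ∈ Finset.Ico a N, f (t + 1) :=
    (Finset.sum_Ico_add' f a N 1).symm
  have hinput (t : ℕ) : concatInput T u (t + 1) (⟨0, hT⟩, l₀) = v (t, l₀) := hv t l₀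
  have hpast {t : ℕ} (ht : t ∈ Finset.Ico a N) (q : Fin T × Fin p) :
      concatInput T u (t + 1) q = v (t - q.1, q.2) := by
    rw [← hv, concatInput, Nat.sub_add_comm]
    have := q.1.2
    have := (Finset.mem_Ico.1 ht).1
    omega
  have hresidual {t : ℕ} (ht : t ∈ Finset.Ico a N) :
      (y (t + 1) - response A B C D T *ᵥ concatInput T u (t + 1)) i =
        freeOutput A C Bw Dz xinit w z t i + ∑ k ∈ Finset.Ico (T - 1) t ×ˢ Finset.univ,
          (C * A ^ k.1 * B) i k.2 * v (t - 1 - k.1, k.2) := by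
    rw [h.residual_eq hT (ha.trans (Nat.succ_le_succ (Finset.mem_Ico.1 ht).1)), Pi.add_apply,
      Finset.sum_apply, Finset.sum_product]
    simp only [Matrix.mulVec, dotProduct]
    refine congrArg _ (Finset.sum_congr rfl fun j hj => Finset.sum_congr rfl fun l _ => ?_)
    rw [← hv, show t - 1 - j + 1 = t - j by have := (Finset.mem_Ico.1 hj).2; omega]
  refine le_trans (le_of_eq ?_) ((hG.sq_sum_residual_mul_concatInput_le (response A B C D T) i
    (⟨0, hT⟩, l₀)).trans_eq ?_)
  · rw [hshift]
    exact congrArg (· ^ 2) (Finset.sum_congr rfl fun t ht => by rw [hresidual ht, hinput])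
  · simp_rw [hshift, hinput]
    exact congrArg _ (Finset.sum_congr rfl fun q _ => congrArg (· ^ 2)
      (Finset.sum_congr rfl fun t ht => by rw [hpast ht]))

variable {Ω : Type*} [MeasurableSpace Ω] {μ : Measure Ω} [IsProbabilityMeasure μ]

lemma IsStdGaussianFamily.measureReal_le_gram_column_sq_le {W : ℕ × Fin p → Ω → ℝ}
    (hW : IsStdGaussianFamily μ W) (ha : T ≤ a + 1) (hN : 0 < N) (hTN : T * p ≤ N) (l₀ : Fin p) :
    μ.real {ω | 864 * (N : ℝ) ^ 2 ≤ ∑ q : Fin T × Fin p,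
      (∑ t ∈ Finset.Ico a N, W (t - q.1, q.2) ω * W (t, l₀) ω) ^ 2} ≤ 1 / 216 := by
  have hcard : ((Finset.Ico a N).card : ℝ) ≤ N := by
    rw [Nat.card_Ico]
    exact_mod_cast Nat.sub_le N a
  have hmean : ∫ ω, ∑ q : Fin T × Fin p,
      (∑ t ∈ Finset.Ico a N, W (t - q.1, q.2) ω * W (t, l₀) ω) ^ 2 ∂μ ≤ 4 * (N : ℝ) ^ 2 :=
    calc _ ≤ 3 * ((Finset.Ico a N).card : ℝ) ^ 2 + T * p * (Finset.Ico a N).card :=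
          hW.integral_gram_column_sq_le
            (fun t ht => ha.trans (Nat.succ_le_succ (Finset.mem_Ico.1 ht).1)) l₀
      _ ≤ 3 * (N : ℝ) ^ 2 + N * N := by
          gcongr
          exact_mod_cast hTN
      _ = 4 * (N : ℝ) ^ 2 := by ring
  have hmarkov := (mul_meas_ge_le_integral_of_nonneg
    (ae_of_all μ fun ω => Finset.sum_nonneg fun q _ => sq_nonneg _)
    (integrable_finsetSum _ fun q _ => (hW.hasFiniteMoments_sum_mul_pow _ _ _ _).integrable)
    (864 * (N : ℝ) ^ 2)).trans hmean
  have hN' : (0 : ℝ) < (N : ℝ) ^ 2 := by positivity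
  rw [show 4 * (N : ℝ) ^ 2 = 864 * (N : ℝ) ^ 2 * (1 / 216) by ring] at hmarkov
  exact le_of_mul_le_mul_left hmarkov (by positivity)

variable {u : ℕ → Ω → Fin p → ℝ} {x : ℕ → Ω → Fin n → ℝ} {y : ℕ → Ω → Fin m → ℝ}
  {Ghat : Ω → Matrix (Fin m) (Fin T × Fin p) ℝ}
  (hu : IsGaussianInput μ u)
  (htraj : ∀ᵐ ω ∂μ, IsTrajectory A B C D Bw Dz xinit (fun t => u t ω) w z (fun t => x t ω)
    (fun t => y t ω))
  (hols : ∀ᵐ ω ∂μ, IsOLS T (a + 1) N (fun t => u t ω) (fun t => y t ω) (Ghat ω))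
include hu htraj hols

lemma le_measureReal_rowEnergy_le_error_sq (hT : 1 ≤ T) (ha : T ≤ a + 1) (hTN : T * p ≤ N)
    (i : Fin m) (hpos : 0 < ∑ t ∈ Finset.Ico a N, ∑ k ∈ Finset.Ico (T - 1) t ×ˢ Finset.univ,
      (C * A ^ k.1 * B) i k.2 ^ 2) :
    1 / 216 ≤ μ.real {ω | 1 / 2 * ∑ t ∈ Finset.Ico a N,
        ∑ k ∈ Finset.Ico (T - 1) t ×ˢ Finset.univ, (C * A ^ k.1 * B) i k.2 ^ 2 ≤
      ‖Ghat ω - response A B C D T‖ ^ 2 * (864 * (N : ℝ) ^ 2)} := by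
  obtain ⟨W, hW, huW⟩ := hu.exists_isStdGaussianFamily
  obtain ⟨t, ht, hne⟩ := Finset.exists_ne_zero_of_sum_ne_zero hpos.ne'
  obtain ⟨⟨-, l₀⟩, -, -⟩ := Finset.exists_ne_zero_of_sum_ne_zero hne
  have hcorr := hW.le_measureReal_half_energy_le_correlation_sq
    (b := fun t => freeOutput A C Bw Dz xinit w z t i)
    (h := fun _ k => (C * A ^ k.1 * B) i k.2) (S := fun t => Finset.Ico (T - 1) t ×ˢ Finset.univ)
    (f := fun t k => (t - 1 - k.1, k.2))
    (fun t j hj k hk hjk => by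
      simp only [Finset.coe_product, Set.mem_prod, Finset.coe_Ico, Set.mem_Ico] at hj hk
      rw [Prod.mk.injEq] at hjk
      exact Prod.ext (by omega) hjk.2)
    (fun t k hk => by
      have := (Finset.mem_Ico.1 (Finset.mem_product.1 hk).1).2
      omega) l₀ hpos
  have hgram := hW.measureReal_le_gram_column_sq_le ha
    (Nat.zero_lt_of_lt (Finset.mem_Ico.1 ht).2) hTN l₀
  have hsplit := hcorr.trans (measureReal_le_le_measureReal_le_mul_add
    (fun ω => sq_nonneg ‖Ghat ω - response A B C D T‖)
    ((huW.and (htraj.and hols)).mono fun ω hω =>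
      hω.2.2.sq_correlation_le (v := fun k => W k ω) hω.2.1 hω.1 hT ha i l₀)
    _ (864 * (N : ℝ) ^ 2))
  linarith

theorem le_measureReal_markovEnergy_le_error_sq (hT : 1 ≤ T) (ha : T ≤ a + 1) (hTN : T * p ≤ N)
    (hpos : 0 < ∑ t ∈ Finset.Ico a N, ∑ r ∈ Finset.Ico (T - 1) t, markovEnergy A B C r) :
    1 / 216 ≤ μ.real {ω | ∑ t ∈ Finset.Ico a N, ∑ r ∈ Finset.Ico (T - 1) t, markovEnergy A B C r ≤
      1728 * m * (N : ℝ) ^ 2 * ‖Ghat ω - response A B C D T‖ ^ 2} := by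
  set E := ∑ t ∈ Finset.Ico a N, ∑ r ∈ Finset.Ico (T - 1) t, markovEnergy A B C r with hE
  let rowEnergy (i : Fin m) : ℝ := ∑ t ∈ Finset.Ico a N,
    ∑ k ∈ Finset.Ico (T - 1) t ×ˢ Finset.univ, (C * A ^ k.1 * B) i k.2 ^ 2
  have hsum : E = ∑ i, rowEnergy i := by
    simp only [hE, rowEnergy, markovEnergy, Finset.sum_product]
    rw [Finset.sum_comm]
    exact Finset.sum_congr rfl fun t _ => Finset.sum_comm
  have hm : (Finset.univ : Finset (Fin m)).Nonempty :=
    Finset.nonempty_of_sum_ne_zero (hsum ▸ hpos.ne')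
  have hmpos : (0 : ℝ) < m := by
    exact_mod_cast Fin.pos_iff_nonempty.2 (Finset.univ_nonempty_iff.1 hm)
  obtain ⟨i, -, hi⟩ : ∃ i ∈ Finset.univ, E / m ≤ rowEnergy i :=
    Finset.exists_le_of_sum_le hm (by
      rw [← hsum, Finset.sum_const, Finset.card_univ, Fintype.card_fin, nsmul_eq_mul,
        mul_div_cancel₀ _ hmpos.ne'])
  refine (le_measureReal_rowEnergy_le_error_sq hu htraj hols hT ha hTN i
    ((div_pos hpos hmpos).trans_le hi)).trans (measureReal_mono fun ω hω => ?_)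
  rw [div_le_iff₀ hmpos] at hi
  calc E ≤ 2 * (1 / 2 * rowEnergy i) * m := by linarith
    _ ≤ 2 * (‖Ghat ω - response A B C D T‖ ^ 2 * (864 * (N : ℝ) ^ 2)) * m :=
        mul_le_mul_of_nonneg_right (mul_le_mul_of_nonneg_left hω two_pos.le) hmpos.le
    _ = _ := by ring

end LowerBound

section Asymptotics

lemma hasBinomialGrowth_zero_map_of_one_le_spectralRadius {n : ℕ} {A : Matrix (Fin n) (Fin n) ℝ}
    (h : 1 ≤ spectralRadius ℂ (A.map fun a : ℝ => (a : ℂ))) :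
    HasBinomialGrowth (A.map fun a : ℝ => (a : ℂ)) 0 := by
  cases subsingleton_or_nontrivial (Matrix (Fin n) (Fin n) ℂ) with
  | inl _ => simp [spectrum.SpectralRadius.of_subsingleton] at h
  | inr _ =>
    have : NormOneClass (Matrix (Fin n) (Fin n) ℂ) := ⟨CStarRing.norm_one⟩
    exact hasBinomialGrowth_zero_of_one_le_spectralRadius h

theorem IsMinimal.exists_mul_pow_le_error {n m p d : ℕ} {A : Matrix (Fin n) (Fin n) ℝ}
    {B : Matrix (Fin n) (Fin p) ℝ} {C : Matrix (Fin m) (Fin n) ℝ} (hmin : IsMinimal A B C)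
    (hg : HasBinomialGrowth (A.map fun a : ℝ => (a : ℂ)) d) :
    ∃ K : ℝ, 0 < K ∧ ∀ (D : Matrix (Fin m) (Fin p) ℝ) (dw dz : ℕ)
      (Bw : Matrix (Fin n) (Fin dw) ℝ) (Dz : Matrix (Fin m) (Fin dz) ℝ) (xinit : Fin n → ℝ)
      (w : ℕ → Fin dw → ℝ) (z : ℕ → Fin dz → ℝ) (T : ℕ), 1 ≤ T →
      ∃ N₀ : ℕ, ∀ N : ℕ, N₀ ≤ N → ∀ N₁ : ℕ, T ≤ N₁ → 2 * N₁ ≤ N →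
        ∀ (Ω : Type*) [MeasurableSpace Ω] (μ : Measure Ω) [IsProbabilityMeasure μ]
          (u : ℕ → Ω → Fin p → ℝ) (x : ℕ → Ω → Fin n → ℝ) (y : ℕ → Ω → Fin m → ℝ)
          (Ghat : Ω → Matrix (Fin m) (Fin T × Fin p) ℝ),
          IsGaussianInput μ u →
          (∀ᵐ ω ∂μ, IsTrajectory A B C D Bw Dz xinit (fun t => u t ω) w z (fun t => x t ω)
            (fun t => y t ω)) →
          (∀ᵐ ω ∂μ, IsOLS T N₁ N (fun t => u t ω) (fun t => y t ω) (Ghat ω)) →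
          1 / 216 ≤ μ.real {ω | K * (N : ℝ) ^ d ≤ ‖Ghat ω - response A B C D T‖} := by
  obtain ⟨c, hc, henergy⟩ := hmin.exists_mul_pow_le_sum_sum_markovEnergy hg
  refine ⟨√(c / (1728 * (m + 1))), by positivity, fun D dw dz Bw Dz xinit w z T hT => ?_⟩
  obtain ⟨N₀, hN₀⟩ := eventually_atTop.1 (henergy (T - 1))
  refine ⟨max N₀ (max 1 (T * p)), fun N hN N₁ hTN₁ hN₁ Ω _ μ _ u x y Ghat hu htraj hols => ?_⟩
  simp only [max_le_iff] at hN
  obtain ⟨a, rfl⟩ := Nat.exists_eq_add_of_le' (hT.trans hTN₁)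
  have hNpos : (0 : ℝ) < N := by exact_mod_cast hN.2.1
  have hE := hN₀ N hN.1 a (by omega)
  refine (le_measureReal_markovEnergy_le_error_sq hu htraj hols hT hTN₁ hN.2.2
    (hE.trans_lt' (by positivity))).trans (measureReal_mono fun ω hω => ?_)
  refine (sq_le_sq₀ (by positivity) (norm_nonneg _)).1 ?_
  rw [mul_pow, Real.sq_sqrt (by positivity), div_mul_eq_mul_div, div_le_iff₀ (by positivity)]
  refine le_of_mul_le_mul_right ?_ (pow_pos hNpos 2)
  calc c * ((N : ℝ) ^ d) ^ 2 * (N : ℝ) ^ 2 = c * (N : ℝ) ^ (2 * d + 2) := by ring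
    _ ≤ 1728 * m * (N : ℝ) ^ 2 * ‖Ghat ω - response A B C D T‖ ^ 2 := hE.trans hω
    _ ≤ 1728 * (m + 1) * (N : ℝ) ^ 2 * ‖Ghat ω - response A B C D T‖ ^ 2 := by
        gcongr
        linarith
    _ = _ := by ring

end Asymptotics

end OLSLowerBound

theorem mainTheorem7_general :
    (∃ c : ℝ, 0 < c ∧
      ∀ (n m p k : ℕ) (A : Matrix (Fin n) (Fin n) ℝ) (B : Matrix (Fin n) (Fin p) ℝ)
        (C : Matrix (Fin m) (Fin n) ℝ),
        OLSLowerBound.IsMinimal A B C →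
        (∃ ev : ℂ, 1 ≤ ‖ev‖ ∧ OLSLowerBound.HasJordanBlock A ev k) →
        ∃ K : ℝ, 0 < K ∧
          ∀ (D : Matrix (Fin m) (Fin p) ℝ) (dw dz : ℕ) (Bw : Matrix (Fin n) (Fin dw) ℝ)
            (Dz : Matrix (Fin m) (Fin dz) ℝ) (xinit : Fin n → ℝ) (w : ℕ → Fin dw → ℝ)
            (z : ℕ → Fin dz → ℝ) (T : ℕ), 1 ≤ T →
            ∃ N₀ : ℕ, ∀ N : ℕ, N₀ ≤ N → ∀ N₁ : ℕ, T ≤ N₁ → 2 * N₁ ≤ N →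
              ∀ (Ω : Type*) [MeasurableSpace Ω] (μ : Measure Ω) [IsProbabilityMeasure μ]
                (u : ℕ → Ω → Fin p → ℝ) (x : ℕ → Ω → Fin n → ℝ) (y : ℕ → Ω → Fin m → ℝ)
                (Ghat : Ω → Matrix (Fin m) (Fin T × Fin p) ℝ),
                OLSLowerBound.IsGaussianInput μ u →
                (∀ᵐ ω ∂μ, OLSLowerBound.IsTrajectory A B C D Bw Dz xinit (fun t => u t ω) w z
                  (fun t => x t ω) (fun t => y t ω)) →
                (∀ᵐ ω ∂μ, OLSLowerBound.IsOLS T N₁ N (fun t => u t ω) (fun t => y t ω) (Ghat ω)) →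
                c ≤ μ.real {ω | K * (N : ℝ) ^ (k - 1) ≤
                  ‖Ghat ω - OLSLowerBound.response A B C D T‖}) ∧
    (∀ (n m p : ℕ) (A : Matrix (Fin n) (Fin n) ℝ) (B : Matrix (Fin n) (Fin p) ℝ)
        (C : Matrix (Fin m) (Fin n) ℝ) (D : Matrix (Fin m) (Fin p) ℝ) (dw dz : ℕ)
        (Bw : Matrix (Fin n) (Fin dw) ℝ) (Dz : Matrix (Fin m) (Fin dz) ℝ) (xinit : Fin n → ℝ)
        (w : ℕ → Fin dw → ℝ) (z : ℕ → Fin dz → ℝ) (T : ℕ),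
        OLSLowerBound.IsMinimal A B C →
        1 ≤ spectralRadius ℂ (A.map fun a : ℝ => (a : ℂ)) →
        1 ≤ T →
        ∀ N₁ : ℕ → ℕ, (∃ᶠ N in atTop, T ≤ N₁ N ∧ 2 * N₁ N ≤ N) →
          ∀ (Ω : Type*) [MeasurableSpace Ω] (μ : Measure Ω) [IsProbabilityMeasure μ]
            (u : ℕ → Ω → Fin p → ℝ) (x : ℕ → Ω → Fin n → ℝ) (y : ℕ → Ω → Fin m → ℝ)
            (Ghat : ℕ → Ω → Matrix (Fin m) (Fin T × Fin p) ℝ),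
            OLSLowerBound.IsGaussianInput μ u →
            (∀ᵐ ω ∂μ, OLSLowerBound.IsTrajectory A B C D Bw Dz xinit (fun t => u t ω) w z
              (fun t => x t ω) (fun t => y t ω)) →
            (∀ᶠ N in atTop, ∀ᵐ ω ∂μ,
              OLSLowerBound.IsOLS T (N₁ N) N (fun t => u t ω) (fun t => y t ω) (Ghat N ω)) →
            ¬ TendstoInMeasure μ Ghat atTop
              (fun _ => OLSLowerBound.response A B C D T)) := by
  refine ⟨⟨1 / 216, by norm_num, ?_⟩, ?_⟩
  · rintro n m p k A B C hmin ⟨ev, hev, hblock⟩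
    exact hmin.exists_mul_pow_le_error (hblock.hasBinomialGrowth hev)
  · intro n m p A B C D dw dz Bw Dz xinit w z T hmin hρ hT N₁ hN₁ Ω _ μ _ u x y Ghat hu htraj hols
    obtain ⟨K, hK, hbound⟩ := hmin.exists_mul_pow_le_error
      (OLSLowerBound.hasBinomialGrowth_zero_map_of_one_le_spectralRadius hρ)
    obtain ⟨N₀, hN₀⟩ := hbound D dw dz Bw Dz xinit w z T hT
    refine OLSLowerBound.not_tendstoInMeasure_of_frequently_le_measureReal hK
      (by norm_num : (0 : ℝ) < 1 / 216) ?_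
    refine (hN₁.and_eventually (hols.and (eventually_ge_atTop N₀))).mono
      fun N ⟨⟨hTN₁, hN₁N⟩, holsN, hN⟩ => ?_
    simpa only [pow_zero, mul_one] using
      hN₀ N hN (N₁ N) hTN₁ hN₁N Ω μ u x y (Ghat N) hu htraj holsN

theorem mainTheorem7 :
    -- quantitative lower bound, with a universal probability `c`
    (∃ c : ℝ, 0 < c ∧
      ∀ (n m p k : ℕ) (A : Matrix (Fin n) (Fin n) ℝ) (B : Matrix (Fin n) (Fin p) ℝ)
        (C : Matrix (Fin m) (Fin n) ℝ),
        OLSLowerBound.IsMinimal A B C →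
        (∃ ev : ℂ, ‖ev‖ = 1 ∧ OLSLowerBound.HasJordanBlock A ev k) →
        ∃ K : ℝ, 0 < K ∧
          ∀ (D : Matrix (Fin m) (Fin p) ℝ) (dw dz : ℕ) (Bw : Matrix (Fin n) (Fin dw) ℝ)
            (Dz : Matrix (Fin m) (Fin dz) ℝ) (xinit : Fin n → ℝ) (T : ℕ), 1 ≤ T →
            ∃ N₀ : ℕ, ∀ N : ℕ, N₀ ≤ N → ∀ N₁ : ℕ, T ≤ N₁ → 10 * N₁ ≤ N →
              ∀ (Ω : Type*) [MeasurableSpace Ω] (μ : Measure Ω) [IsProbabilityMeasure μ]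
                (u : ℕ → Ω → Fin p → ℝ) (x : ℕ → Ω → Fin n → ℝ) (y : ℕ → Ω → Fin m → ℝ)
                (Ghat : Ω → Matrix (Fin m) (Fin T × Fin p) ℝ),
                OLSLowerBound.IsGaussianInput μ u →
                (∀ ω, OLSLowerBound.IsTrajectory A B C D Bw Dz xinit (fun t => u t ω)
                  (fun _ => 0) (fun _ => 0) (fun t => x t ω) (fun t => y t ω)) →
                (∀ᵐ ω ∂μ, OLSLowerBound.IsOLS T N₁ N (fun t => u t ω) (fun t => y t ω) (Ghat ω)) →
                c ≤ μ.real {ω | K * (N : ℝ) ^ (k - 1) ≤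
                  ‖Ghat ω - OLSLowerBound.response A B C D T‖}) ∧
    -- inconsistency of OLS for marginally stable systems
    (∀ (n m p : ℕ) (A : Matrix (Fin n) (Fin n) ℝ) (B : Matrix (Fin n) (Fin p) ℝ)
        (C : Matrix (Fin m) (Fin n) ℝ) (D : Matrix (Fin m) (Fin p) ℝ) (dw dz : ℕ)
        (Bw : Matrix (Fin n) (Fin dw) ℝ) (Dz : Matrix (Fin m) (Fin dz) ℝ) (xinit : Fin n → ℝ)
        (T : ℕ),
        OLSLowerBound.IsMinimal A B C →
        spectralRadius ℂ (A.map fun a : ℝ => (a : ℂ)) = 1 →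
        1 ≤ T →
        ∀ N₁ : ℕ → ℕ, (∀ᶠ N in atTop, T ≤ N₁ N ∧ 10 * N₁ N ≤ N) →
          ∀ (Ω : Type*) [MeasurableSpace Ω] (μ : Measure Ω) [IsProbabilityMeasure μ]
            (u : ℕ → Ω → Fin p → ℝ) (x : ℕ → Ω → Fin n → ℝ) (y : ℕ → Ω → Fin m → ℝ)
            (Ghat : ℕ → Ω → Matrix (Fin m) (Fin T × Fin p) ℝ),
            OLSLowerBound.IsGaussianInput μ u →
            (∀ ω, OLSLowerBound.IsTrajectory A B C D Bw Dz xinit (fun t => u t ω)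
              (fun _ => 0) (fun _ => 0) (fun t => x t ω) (fun t => y t ω)) →
            (∀ᶠ N in atTop, ∀ᵐ ω ∂μ,
              OLSLowerBound.IsOLS T (N₁ N) N (fun t => u t ω) (fun t => y t ω) (Ghat N ω)) →
            ¬ TendstoInMeasure μ Ghat atTop
              (fun _ => OLSLowerBound.response A B C D T)) := by
  obtain ⟨⟨c, hc, hbound⟩, hinconsistent⟩ := mainTheorem7_general
  refine ⟨⟨c, hc, ?_⟩, ?_⟩
  · rintro n m p k A B C hmin ⟨ev, hev, hblock⟩
    obtain ⟨K, hK, hK'⟩ := hbound n m p k A B C hmin ⟨ev, hev.ge, hblock⟩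
    refine ⟨K, hK, fun D dw dz Bw Dz xinit T hT => ?_⟩
    obtain ⟨N₀, hN₀⟩ := hK' D dw dz Bw Dz xinit (fun _ => 0) (fun _ => 0) T hT
    exact ⟨N₀, fun N hN N₁ hTN₁ hN₁ Ω _ μ _ u x y Ghat hu htraj =>
      hN₀ N hN N₁ hTN₁ (by omega) Ω μ u x y Ghat hu (ae_of_all μ htraj)⟩
  · exact fun n m p A B C D dw dz Bw Dz xinit T hmin hρ hT N₁ hN₁ Ω _ μ _ u x y Ghat hu htraj =>
      hinconsistent n m p A B C D dw dz Bw Dz xinit _ _ T hmin hρ.ge hT N₁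
        (hN₁.mono fun N hN => ⟨hN.1, by omega⟩).frequently Ω μ u x y Ghat hu (ae_of_all μ htraj)
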